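/- Fix a constant $c\ge 1$. Consider inputs consisting of 1. a finite alphabet $\Sigma$, a finite set $V$ of variables and a *functional*, possibly ambiguous, variable-set automaton (vset-automaton) $A=(\Sigma,V,Q,I,F,\delta)$ over the Boolean semiring, that is, a nondeterministic finite automaton with $\varepsilon$-transitions over the alphabet $\Sigma\cup\{\vdash_x,\dashv_x \mid x\in V\}$ such that in every accepted word (ref-word) $r$, for every $x\in V$, each of $\vdash_x$ and $\dashv_x$ occurs exactly once and $\vdash_x$ occurs before $\dashv_x$; 2. a document $d\in\Sigma^*$; 3. a *constant-width weight function* of width at most $c$: a set $X\subseteq V$ of at most $c$ variables and a function $R:(\Sigma^*)^X\to\mathbb{Q}$ of finite support, given as a finite table of pairwise distinct $X$-tuples of strings with their values (tuples that are not listed have value $0$); rational numbers are written with numerator and denominator in binary. Let $\mathrm{doc}(r)$ be the word obtained from a ref-word $r$ by erasing all $\vdash_x,\dashv_x$. An accepted ref-word $r$ with $\mathrm{doc}(r)=d$ encodes the tuple $t$ that maps each $x\in V$ to the span $[i_x,j_x\rangle$ with $i_x=|\mathrm{doc}(r')|+1$ and $j_x=i_x+|\mathrm{doc}(r'')|$,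 where $r=r'\cdot\vdash_x\cdot\, r''\cdot\dashv_x\cdot\, r'''$. Let $[\![A]\!](d)$ be the set of all tuples encoded by accepted ref-words $r$ with $\mathrm{doc}(r)=d$. For a span $[i,j\rangle$ of $d=\sigma_1\cdots\sigma_n$ let $d_{[i,j\rangle}=\sigma_i\cdots\sigma_{j-1}$. The weight of a tuple is $w(d,t)=R\big((d_{t(x)})_{x\in X}\big)$. Then the functions $$\mathrm{Min}(A,d,w)=\min_{t\in[\![A]\!](d)}w(d,t)\qquad\text{and}\qquad \mathrm{Max}(A,d,w)=\max_{t\in[\![A]\!](d)}w(d,t),$$ with a distinguished value "undefined" if $[\![A]\!](d)=\emptyset$, are in $\mathrm{FP}$: for each of them there is a Turing machine that computes it from an encoding of the input in time polynomial in the length of that encoding (combined complexity; $c$ is fixed, while $A$, $d$, $X$ and $R$ are all part of the input). -/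

import Mathlib

namespace DocSpanner

/-! ### Documents, spans and tuples -/

/-- A span `[i, j⟩` of the document `d = σ₁ ⋯ σₙ`, that is, `1 ≤ i ≤ j ≤ n + 1`. -/
@[ext]
structure Span {α : Type} (d : List α) where
  i : ℕ
  j : ℕ
  one_le : 1 ≤ i
  le : i ≤ j
  le_length : j ≤ d.length + 1

instance {α : Type} (d : List α) : Finite (Span d) := by
  refine Finite.of_injective
    (fun s : Span d =>
      ((⟨s.i, by have := s.le; have := s.le_length; omega⟩,
        ⟨s.j, by have := s.le_length; omega⟩) : Fin (d.length + 2) × Fin (d.length + 2))) ?_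
  intro s t h
  simp only [Prod.mk.injEq, Fin.mk.injEq] at h
  exact Span.ext h.1 h.2

/-- The string `σ_i ⋯ σ_{j-1}` selected by the span `[i, j⟩` of `d`. -/
def Span.str {α : Type} {d : List α} (s : Span d) : List α :=
  (d.drop (s.i - 1)).take (s.j - s.i)

/-- A `d`-tuple over the variables `V`. -/
abbrev Tuple {α : Type} (d : List α) (V : Type) : Type := V → Span d

/-! ### Ref-words -/

/-- The extended alphabet: the letters, and for each variable `x` the operations that open and
close `x`. -/
inductive RefLetter (α V : Type) : Type
  | sym (a : α)
  | vopen (x : V)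
  | vclose (x : V)
  deriving DecidableEq

/-- The document of a ref-word: all variable operations are erased. -/
def doc {α V : Type} (r : List (RefLetter α V)) : List α :=
  r.filterMap fun
    | .sym a => some a
    | .vopen _ => none
    | .vclose _ => none

/-- A ref-word in which each variable of `V` is opened exactly once and closed exactly once, the
latter after the former. -/
def ValidRef {α V : Type} [DecidableEq α] [DecidableEq V] (r : List (RefLetter α V)) : Prop :=
  ∀ x : V, r.count (.vopen x) = 1 ∧ r.count (.vclose x) = 1 ∧
    ∃ pre mid post, r = pre ++ [.vopen x] ++ mid ++ [.vclose x] ++ post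

/-- `t` is the tuple that the ref-word `r` encodes: if `r = pre · open x · mid · close x · post`,
then `t x = [i, j⟩` with `i = |doc pre| + 1` and `j = i + |doc mid|`. -/
def Encodes {α V : Type} {d : List α} (r : List (RefLetter α V)) (t : Tuple d V) : Prop :=
  ∀ x : V, ∃ pre mid post, r = pre ++ [.vopen x] ++ mid ++ [.vclose x] ++ post ∧
    (t x).i = (doc pre).length + 1 ∧ (t x).j = (t x).i + (doc mid).length

/-! ### Variable-set automata -/

/-- A vset-automaton (over the Boolean semiring) with alphabet `α`, variables `V` and states `Q`.
Transitions are labelled with `none` (the empty word) or with a letter of the extended alphabet. -/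
structure VSA (α V Q : Type) where
  init : Q → Bool
  final : Q → Bool
  delta : Q → Option (RefLetter α V) → Q → Bool

namespace VSA

variable {α V Q : Type}

/-- The underlying finite automaton with `ε`-transitions. -/
def toεNFA (A : VSA α V Q) : εNFA (RefLetter α V) Q where
  step p o := {q | A.delta p o q = true}
  start := {q | A.init q = true}
  accept := {q | A.final q = true}

/-- The language of all ref-words on which `A` has a run. -/
def refLang (A : VSA α V Q) : Language (RefLetter α V) := A.toεNFA.accepts

/-- `A` is functional. -/
def Functional [DecidableEq α] [DecidableEq V] (A : VSA α V Q) : Prop :=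
  ∀ r ∈ A.refLang, ValidRef r

/-- The set of tuples that the spanner represented by `A` extracts from the document `d`. -/
def spanner (A : VSA α V Q) (d : List α) : Set (Tuple d V) :=
  {t | ∃ r ∈ A.refLang, doc r = d ∧ Encodes r t}

end VSA

/-! ### Instances of the aggregation problems -/

/-- An instance of the problems Min and Max for functional vset-automata and constant-width weight
functions of width at most `c`. The alphabet, the variables and the states are
`{0, …, numSyms - 1}`, `{0, …, numVars - 1}` and `{0, …, numStates - 1}`; all of them are part of
the input. The weight function is given by the set `X` of its variables, listed without
repetition, and by the table `rows` of a `ℚ`-relation over `X`. -/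
structure Instance (c : ℕ) where
  numSyms : ℕ
  numVars : ℕ
  numStates : ℕ
  aut : VSA (Fin numSyms) (Fin numVars) (Fin numStates)
  functional : aut.Functional
  document : List (Fin numSyms)
  width : ℕ
  width_le : width ≤ c
  X : Fin width ↪ Fin numVars
  rows : List ((Fin width → List (Fin numSyms)) × ℚ)
  rows_nodup : (rows.map Prod.fst).Nodup

namespace Instance

variable {c : ℕ}

/-- The `ℚ`-relation given by the table: a listed tuple has the listed value, any other tuple has
the value `0`. -/
noncomputable def relation (I : Instance c) :
    (Fin I.width → List (Fin I.numSyms)) →₀ ℚ :=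
  (I.rows.map fun row => Finsupp.single row.1 row.2).sum

/-- The weight of a tuple: the value of the relation at the strings that the tuple selects with
the variables of `X`. -/
noncomputable def weight (I : Instance c) (t : Tuple I.document (Fin I.numVars)) : ℚ :=
  I.relation fun l => (t (I.X l)).str

/-- The finite set of weights of the tuples that the spanner extracts from the document. -/
noncomputable def img (I : Instance c) : Finset ℚ :=
  (Set.toFinite (I.weight '' I.aut.spanner I.document)).toFinset

/-- The minimal weight of an extracted tuple (`none` if no tuple is extracted). -/
noncomputable def minAgg (I : Instance c) : Option ℚ :=
  if h : I.img.Nonempty then some (I.img.min' h) else none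

/-- The maximal weight of an extracted tuple (`none` if no tuple is extracted). -/
noncomputable def maxAgg (I : Instance c) : Option ℚ :=
  if h : I.img.Nonempty then some (I.img.max' h) else none

end Instance

/-! ### Encoding of instances and values as words over a finite alphabet -/

open Computability (Γ')

/-- Sizes and indices are written in unary; this is polynomially equivalent to binary, since the
size of an automaton is at least the number of its states, letters and variables. -/
def encIndex (n : ℕ) : List Γ' := List.replicate n (Γ'.bit true) ++ [Γ'.comma]

/-- Numbers inside weights are written in binary. -/
def encBinary (n : ℕ) : List Γ' := (Computability.encodeNat n).map Γ'.bit ++ [Γ'.comma]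

/-- A rational number: its sign, and its numerator and denominator in lowest terms. -/
def encRat (q : ℚ) : List Γ' :=
  Γ'.bit (decide (q < 0)) :: (encBinary q.num.natAbs ++ encBinary q.den)

/-- A list: each entry is preceded by `bra`, and the list ends with `ket`. -/
def encList {β : Type} (enc : β → List Γ') (l : List β) : List Γ' :=
  l.flatMap (fun b => Γ'.bra :: enc b) ++ [Γ'.ket]

/-- The label of a transition. -/
def encLabel {s k : ℕ} : Option (RefLetter (Fin s) (Fin k)) → List Γ'
  | none => encIndex 0
  | some (.sym a) => encIndex 1 ++ encIndex a
  | some (.vopen x) => encIndex 2 ++ encIndex x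
  | some (.vclose x) => encIndex 3 ++ encIndex x

/-- All possible labels of transitions. -/
def allLabels (s k : ℕ) : List (Option (RefLetter (Fin s) (Fin k))) :=
  none :: ((List.finRange s).map (fun a => some (.sym a)) ++
    (List.finRange k).map (fun x => some (.vopen x)) ++
    (List.finRange k).map (fun x => some (.vclose x)))

/-- A vset-automaton: the list of initial states, the list of accepting states and the list of
transitions. -/
def encVSA {s k n : ℕ} (A : VSA (Fin s) (Fin k) (Fin n)) : List Γ' :=
  encList (fun q : Fin n => encIndex q) ((List.finRange n).filter A.init) ++
  encList (fun q : Fin n => encIndex q) ((List.finRange n).filter A.final) ++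
  encList (fun e : Fin n × Option (RefLetter (Fin s) (Fin k)) × Fin n =>
      encIndex e.1 ++ encLabel e.2.1 ++ encIndex e.2.2)
    ((List.finRange n ×ˢ (allLabels s k ×ˢ List.finRange n)).filter
      fun e => A.delta e.1 e.2.1 e.2.2)

/-- A string over the alphabet `{0, …, s - 1}`. -/
def encString {s : ℕ} (w : List (Fin s)) : List Γ' := encList (fun a : Fin s => encIndex a) w

/-- An instance. -/
def encInstance {c : ℕ} (I : Instance c) : List Γ' :=
  encIndex I.numSyms ++ encIndex I.numVars ++ encIndex I.numStates ++
  encVSA I.aut ++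
  encString I.document ++
  encList (fun x : Fin I.numVars => encIndex x) (List.ofFn I.X) ++
  encList (fun row : (Fin I.width → List (Fin I.numSyms)) × ℚ =>
      encList encString (List.ofFn row.1) ++ encRat row.2) I.rows

/-- The value of an aggregate; the empty word stands for "no tuple is extracted". -/
def encValue : Option ℚ → List Γ'
  | none => []
  | some q => encRat q

/-! ### Polynomial time -/

/-- A function `f` is in FP (with respect to encodings of its arguments and its values as words)
if a Turing machine computes it in polynomial time. -/
def InFP {β γ Γ₀ Γ₁ : Type} (encIn : β → List Γ₀) (encOut : γ → List Γ₁) (f : β → γ) : Prop :=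
  Nonempty (Turing.TM2ComputableInPolyTime encIn encOut f)

end DocSpanner

/-! The weight of a tuple depends only on its spans for the at most `c` variables of `X`. A span of
`d` is a pair of positions, so there are at most `(|d| + 1) ^ (2 * c)` candidate assignments of
positions to these variables, which is polynomially many for fixed `c`. For each assignment it
suffices to decide whether some extracted tuple agrees with it; then the weight is found by a lookup
in the table, and the best of the weights is selected.

That decision is a reachability problem in the graph whose vertices pair a state with a position of
the document. Letters advance the position, and an operation on a variable of `X` may be passed only
at the prescribed position. Nothing checks that operations are balanced, occur once, or what the
other variables do: functionality guarantees that every accepted ref-word is valid, hence encodes a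
tuple. Ambiguity is harmless, because only the existence of a run matters. The lemmas that carry
this are `mem_reachList`, `acceptsAsg_iff`, `respects_iff` and `mem_weights`; rational numbers are
compared by cross multiplication on binary digits in `leRat_ratRep`.

The time bound requires an actual Turing machine. Structured programs on five stacks with a cost
semantics `Run` are compiled to stack machines (`Run.goes`, `inFP_of_run`). Data are binary trees in
prefix notation, which is self-delimiting, so that the main stack is a stack of trees. The predicate
`PT` says that a function on represented data has a polynomial time program; it is closed under
composition, pairing, case distinction, and folds whose accumulators stay polynomially bounded
(`PT.foldl`). The parser, the arithmetic and the algorithm are then written as ordinary functions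
built from these constructions, so that each of them satisfies `PT`, and `aggWord_eq` identifies the
composite with the two aggregates. -/

namespace DocSpanner

open Computability (Γ')
open Turing Function

/-! ### A structured language for stack machines -/

/-- The stacks: one for input and output, one for data, and three for temporary values. -/
inductive Stk : Type
  | io | main | aux₁ | aux₂ | cnt
  deriving DecidableEq

instance : Fintype Stk where
  elems := {.io, .main, .aux₁, .aux₂, .cnt}
  complete k := by cases k <;> decide

/-- The contents of all stacks. -/
abbrev Store : Type := Stk → List Γ'

/-- Structured programs over the stacks. -/
inductive Cmd : Type
  | push (k : Stk) (s : Γ')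
  | move (k : Stk) (ks : List Stk)
  | seq (c d : Cmd)
  | ite (k : Stk) (p : Option Γ' → Bool) (c d : Cmd)
  | loop (k : Stk) (p : Option Γ' → Bool) (c : Cmd)

/-- Push a symbol on each of the listed stacks. -/
def pushOn (s : Γ') : List Stk → Store → Store
  | [], S => S
  | k :: ks, S => pushOn s ks (update S k (s :: S k))

/-- Cost semantics: the program started with the first store ends with the second one, and the
number bounds its running time. -/
inductive Run : Cmd → Store → Store → ℕ → Prop
  | push (k s S) : Run (.push k s) S (update S k (s :: S k)) 1
  | move (k ks S) : Run (.move k ks) S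
      (pushOn ((S k).head?.getD Γ'.blank) ks (update S k (S k).tail)) (ks.length + 1)
  | seq {c d S S' S'' m n} : Run c S S' m → Run d S' S'' n → Run (.seq c d) S S'' (m + n)
  | iteTrue {k p c d S S' n} : p (S k).head? = true → Run c S S' n →
      Run (.ite k p c d) S S' (n + 1)
  | iteFalse {k p c d S S' n} : p (S k).head? = false → Run d S S' n →
      Run (.ite k p c d) S S' (n + 1)
  | loopFalse {k p c S} : p (S k).head? = false → Run (.loop k p c) S S 1
  | loopTrue {k p c S S' S'' m n} : p (S k).head? = true → Run c S S' m →
      Run (.loop k p c) S' S'' n → Run (.loop k p c) S S'' (m + n + 1)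

/-- The number of symbols on all stacks. -/
def Store.total (S : Store) : ℕ := ∑ k, (S k).length

theorem Store.total_update (S : Store) (k : Stk) (l : List Γ') :
    Store.total (update S k l) + (S k).length = Store.total S + l.length := by
  unfold Store.total
  rw [← Finset.add_sum_erase _ _ (Finset.mem_univ k),
    ← Finset.add_sum_erase (a := k) _ (fun k => (S k).length) (Finset.mem_univ k),
    Finset.sum_congr rfl (g := fun k => (S k).length)]
  · simp only [update_self]; ring
  · intro j hj
    rw [update_of_ne (Finset.ne_of_mem_erase hj)]

theorem total_pushOn (s : Γ') (ks : List Stk) (S : Store) :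
    Store.total (pushOn s ks S) = Store.total S + ks.length := by
  induction ks generalizing S with
  | nil => rfl
  | cons k ks ih =>
    have := Store.total_update S k (s :: S k)
    simp only [pushOn, ih, List.length_cons] at this ⊢
    omega

/-- Each command is charged at least for the symbols it writes, so running time bounds growth. This
is the source of all size bounds for computed values. -/
theorem Run.total_le {c : Cmd} {S S' : Store} {n : ℕ} (h : Run c S S' n) :
    S'.total ≤ S.total + n := by
  induction h with
  | push k s S =>
    have := Store.total_update S k (s :: S k)
    simp only [List.length_cons] at this
    omega
  | move k ks S =>
    have := Store.total_update S k (S k).tail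
    simp only [List.length_tail] at this
    rw [total_pushOn]
    omega
  | _ => omega

/-! ### Compilation to Turing machines -/

/-- The labels of a program. -/
def Cmd.Lbl : Cmd → Type
  | .push _ _ => Unit
  | .move _ _ => Unit
  | .seq c d => c.Lbl ⊕ d.Lbl
  | .ite _ _ c d => Option (c.Lbl ⊕ d.Lbl)
  | .loop _ _ c => Option c.Lbl

instance Cmd.fintypeLbl : (c : Cmd) → Fintype c.Lbl
  | .push _ _ => inferInstanceAs (Fintype Unit)
  | .move _ _ => inferInstanceAs (Fintype Unit)
  | .seq c d =>
    letI := Cmd.fintypeLbl c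
    letI := Cmd.fintypeLbl d
    inferInstanceAs (Fintype (c.Lbl ⊕ d.Lbl))
  | .ite _ _ c d =>
    letI := Cmd.fintypeLbl c
    letI := Cmd.fintypeLbl d
    inferInstanceAs (Fintype (Option (c.Lbl ⊕ d.Lbl)))
  | .loop _ _ c =>
    letI := Cmd.fintypeLbl c
    inferInstanceAs (Fintype (Option c.Lbl))

/-- The label at which a program starts. -/
def Cmd.entry : (c : Cmd) → c.Lbl
  | .push _ _ => ()
  | .move _ _ => ()
  | .seq c _ => Sum.inl c.entry
  | .ite _ _ _ _ => none
  | .loop _ _ _ => none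

/-- Machine statements over the stacks; the internal state holds the symbol read last. -/
abbrev MStmt (Λ : Type) : Type := TM2.Stmt (fun _ : Stk => Γ') Λ (Option Γ')

/-- The statement that pushes the symbol read last on each of the listed stacks. -/
def pushStmt {Λ : Type} (q : MStmt Λ) : List Stk → MStmt Λ
  | [] => q
  | k :: ks => .push k (fun v => v.getD Γ'.blank) (pushStmt q ks)

theorem stepAux_pushStmt {Λ : Type} (q : MStmt Λ) (ks : List Stk) (v : Option Γ') (S : Store) :
    TM2.stepAux (pushStmt q ks) v S = TM2.stepAux q v (pushOn (v.getD Γ'.blank) ks S) := by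
  induction ks generalizing S with
  | nil => rfl
  | cons k ks ih => simp only [pushStmt, TM2.stepAux, ih, pushOn]

/-- The code of a program whose labels are embedded into `Λ` by `e`, and which continues at `x`. -/
def Cmd.code {Λ : Type} : (c : Cmd) → (e : c.Lbl → Λ) → (x : Λ) → c.Lbl → MStmt Λ
  | .push k s, _, x, _ => .push k (fun _ => s) (.goto fun _ => x)
  | .move k ks, _, x, _ => .pop k (fun _ o => o) (pushStmt (.goto fun _ => x) ks)
  | .seq c d, e, _, .inl l => c.code (fun l => e (.inl l)) (e (.inr d.entry)) l
  | .seq _ d, e, x, .inr l => d.code (fun l => e (.inr l)) x l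
  | .ite k p c d, e, _, none => .peek k (fun _ o => o)
      (.branch p (.goto fun _ => e (some (.inl c.entry))) (.goto fun _ => e (some (.inr d.entry))))
  | .ite _ _ c _, e, x, some (.inl l) => c.code (fun l => e (some (.inl l))) x l
  | .ite _ _ _ d, e, x, some (.inr l) => d.code (fun l => e (some (.inr l))) x l
  | .loop k p c, e, x, none => .peek k (fun _ o => o)
      (.branch p (.goto fun _ => e (some c.entry)) (.goto fun _ => x))
  | .loop _ _ c, e, _, some l => c.code (fun l => e (some l)) (e none) l

/-- The machine goes from one label to another in at most `n` steps. -/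
def Goes {Λ : Type} (M : Λ → MStmt Λ) (l : Λ) (S : Store) (l' : Λ) (S' : Store) (n : ℕ) : Prop :=
  ∀ v, ∃ v', Nonempty (StateTransition.EvalsToInTime (TM2.step M)
    ⟨some l, v, S⟩ (some ⟨some l', v', S'⟩) n)

theorem Goes.trans {Λ : Type} {M : Λ → MStmt Λ} {l l' l'' : Λ} {S S' S'' : Store} {m n : ℕ}
    (h : Goes M l S l' S' m) (h' : Goes M l' S' l'' S'' n) : Goes M l S l'' S'' (m + n) := by
  intro v
  obtain ⟨v', ⟨hv⟩⟩ := h v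
  obtain ⟨v'', ⟨hv'⟩⟩ := h' v'
  exact ⟨v'', ⟨by rw [add_comm]; exact hv.trans _ _ _ _ _ _ hv'⟩⟩

theorem Goes.of_step {Λ : Type} {M : Λ → MStmt Λ} {l l' : Λ} {S S' : Store} {n : ℕ}
    (h : ∀ v, ∃ v', TM2.step M ⟨some l, v, S⟩ = some ⟨some l', v', S'⟩) (hn : 1 ≤ n) :
    Goes M l S l' S' n := by
  intro v
  obtain ⟨v', hv⟩ := h v
  exact ⟨v', ⟨⟨⟨1, hv⟩, hn⟩⟩⟩

/-- Only the labels in the image of `e` have to carry the code of `c`, so the induction passes to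
subprograms by composing `e` with the embedding of their labels. The register may hold anything at a
label, since every branch is preceded by a peek. -/
theorem Run.goes {c : Cmd} {S S' : Store} {n : ℕ} (h : Run c S S' n) {Λ : Type}
    {M : Λ → MStmt Λ} {e : c.Lbl → Λ} {x : Λ} (hM : ∀ l, M (e l) = c.code e x l) :
    Goes M (e c.entry) S x S' n := by
  induction h generalizing x with
  | push k s S =>
    refine Goes.of_step (fun v => ⟨v, ?_⟩) le_rfl
    rw [TM2.step, hM]
    rfl
  | move k ks S =>
    refine Goes.of_step (fun v => ⟨(S k).head?, ?_⟩) (by omega)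
    rw [TM2.step, hM]
    simp only [Cmd.code, TM2.stepAux, stepAux_pushStmt]
  | @seq c d _ _ _ _ _ _ _ ih₁ ih₂ =>
    exact (ih₁ (e := fun l => e (.inl l)) (x := e (.inr d.entry)) fun l => hM (.inl l)).trans
      (ih₂ (e := fun l => e (.inr l)) fun l => hM (.inr l))
  | @iteTrue k p c d S _ n hp _ ih =>
    rw [add_comm]
    refine Goes.trans (l' := e (some (.inl c.entry))) (S' := S)
      (Goes.of_step (fun v => ⟨(S k).head?, ?_⟩) le_rfl)
      (ih (e := fun l => e (some (.inl l))) fun l => hM (some (.inl l)))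
    rw [TM2.step, hM]
    simp only [Cmd.code, Cmd.entry, TM2.stepAux, hp, cond_true]
  | @iteFalse k p c d S _ n hp _ ih =>
    rw [add_comm]
    refine Goes.trans (l' := e (some (.inr d.entry))) (S' := S)
      (Goes.of_step (fun v => ⟨(S k).head?, ?_⟩) le_rfl)
      (ih (e := fun l => e (some (.inr l))) fun l => hM (some (.inr l)))
    rw [TM2.step, hM]
    simp only [Cmd.code, Cmd.entry, TM2.stepAux, hp, cond_false]
  | @loopFalse k p c S hp =>
    refine Goes.of_step (fun v => ⟨(S k).head?, ?_⟩) le_rfl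
    rw [TM2.step, hM]
    simp only [Cmd.code, Cmd.entry, TM2.stepAux, hp, cond_false]
  | @loopTrue k p c S S' S'' m n hp _ _ ih₁ ih₂ =>
    rw [add_comm]
    refine Goes.trans (l' := e (some c.entry)) (S' := S)
      (Goes.of_step (fun v => ⟨(S k).head?, ?_⟩) le_rfl)
      -- The body exits to the test label of the loop itself, where the remaining iterations start
      -- with the same code.
      ((ih₁ (e := fun l => e (some l)) (x := e none) fun l => hM (some l)).trans (ih₂ hM))
    rw [TM2.step, hM]
    simp only [Cmd.code, Cmd.entry, TM2.stepAux, hp, cond_true]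

/-- The machine that runs a program and halts. -/
def Cmd.machine (c : Cmd) : FinTM2 where
  K := Stk
  k₀ := .io
  k₁ := .io
  Γ _ := Γ'
  Λ := Option c.Lbl
  main := some c.entry
  σ := Option Γ'
  initialState := none
  Γk₀Fin := inferInstanceAs (Fintype Γ')
  m
    | none => .load (fun _ => none) .halt
    | some l => c.code some none l

/-- The store with the given contents. -/
def st (io main aux₁ aux₂ cnt : List Γ') : Store
  | .io => io
  | .main => main
  | .aux₁ => aux₁
  | .aux₂ => aux₂
  | .cnt => cnt

/-- A program that runs in polynomial time yields a function in FP. -/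
theorem inFP_of_run {β γ : Type} {encIn : β → List Γ'} {encOut : γ → List Γ'} {f : β → γ}
    (c : Cmd) (P : Polynomial ℕ)
    (h : ∀ a, ∃ n ≤ P.eval (encIn a).length,
      Run c (st (encIn a) [] [] [] []) (st (encOut (f a)) [] [] [] []) n) :
    InFP encIn encOut f := by
  -- The words are variables, because the structure to be built presents them as images under the
  -- identity equivalence of alphabets.
  have key : ∀ a (u w : List Γ'), u = encIn a → w = encOut (f a) →
      Nonempty (TM2OutputsInTime c.machine u (some w) ((P + 1).eval (encIn a).length)) := by
    rintro a _ _ rfl rfl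
    obtain ⟨n, hn, hrun⟩ := h a
    obtain ⟨v, ⟨hv⟩⟩ := hrun.goes (M := c.machine.m) (e := some) (x := none) (fun _ => rfl) none
    have h₁ : initList c.machine (encIn a) =
        ⟨some (some c.entry), none, st (encIn a) [] [] [] []⟩ := by
      simp only [initList]
      congr 1
      funext k
      cases k <;> rfl
    have h₂ : haltList c.machine (encOut (f a)) =
        ⟨none, none, st (encOut (f a)) [] [] [] []⟩ := by
      simp only [haltList]
      congr 1
      funext k
      cases k <;> rfl
    refine ⟨?_⟩
    change StateTransition.EvalsToInTime c.machine.step (initList c.machine (encIn a))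
      (some (haltList c.machine (encOut (f a)))) _
    rw [h₁, h₂]
    -- One further step resets the register, as the halting configuration requires its initial
    -- value; this is the `1` in `P + 1`.
    have hlast : StateTransition.EvalsToInTime c.machine.step
        ⟨some none, v, st (encOut (f a)) [] [] [] []⟩
        (some ⟨none, none, st (encOut (f a)) [] [] [] []⟩) 1 := ⟨⟨1, rfl⟩, le_rfl⟩
    have := hv.trans _ _ _ _ _ _ hlast
    refine ⟨this.toEvalsTo, this.steps_le_m.trans ?_⟩
    simp only [Polynomial.eval_add, Polynomial.eval_one]
    omega
  exact ⟨{  tm := c.machine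
            inputAlphabet := Equiv.refl Γ'
            outputAlphabet := Equiv.refl Γ'
            time := P + 1
            outputsFun := fun a => (key a _ _ (List.map_id _) (List.map_id _)).some }⟩


/-! ### Trees as a data type for programs -/

/-- Binary trees, the values that programs compute with. -/
inductive BTree : Type
  | nil
  | node (a b : BTree)

namespace BTree

/-- The number of nodes of a tree. -/
def size : BTree → ℕ
  | nil => 1
  | node a b => a.size + b.size + 1

/-- Trees in prefix notation. -/
def ser : BTree → List Γ'
  | nil => [.bit false]
  | node a b => .bit true :: (a.ser ++ b.ser)

@[simp] theorem length_ser (t : BTree) : t.ser.length = t.size := by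
  induction t with
  | nil => rfl
  | node a b iha ihb => simp [ser, size, iha, ihb]

theorem size_pos (t : BTree) : 1 ≤ t.size := by
  cases t <;> simp [size]

end BTree

/-- Types whose elements are represented by trees. -/
class Enc (α : Type) where
  enc : α → BTree

open Enc

/-- The size of the representation. -/
def sz {α : Type} [Enc α] (a : α) : ℕ := (enc a).size

instance : Enc Unit := ⟨fun _ => .nil⟩

instance : Enc Bool := ⟨fun b => cond b (.node .nil .nil) .nil⟩

instance {α β : Type} [Enc α] [Enc β] : Enc (α × β) := ⟨fun p => .node (enc p.1) (enc p.2)⟩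

/-- The representation of a list. -/
def encListTree {α : Type} [Enc α] : List α → BTree
  | [] => .nil
  | a :: l => .node (enc a) (encListTree l)

instance {α : Type} [Enc α] : Enc (List α) := ⟨encListTree⟩

/-- The representation of a natural number, in unary. -/
def encNatTree : ℕ → BTree
  | 0 => .nil
  | n + 1 => .node .nil (encNatTree n)

instance : Enc ℕ := ⟨encNatTree⟩

instance {α : Type} [Enc α] : Enc (Option α) :=
  ⟨fun o => o.elim .nil fun a => .node (enc a) .nil⟩

/-- The position of a symbol in a list of all symbols. -/
def symIndex : Γ' → ℕ
  | .bit false => 0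
  | .bit true => 1
  | .comma => 2
  | .bra => 3
  | .ket => 4
  | .blank => 5

instance : Enc Γ' := ⟨fun s => enc (symIndex s)⟩

section Size

variable {α β : Type} [Enc α] [Enc β]

theorem sz_pos (a : α) : 1 ≤ sz a := BTree.size_pos _

@[simp] theorem sz_unit (a : Unit) : sz a = 1 := rfl

theorem sz_bool (b : Bool) : sz b ≤ 3 := by cases b <;> decide

@[simp] theorem sz_prod (p : α × β) : sz p = sz p.1 + sz p.2 + 1 := rfl

@[simp] theorem sz_nil : sz ([] : List α) = 1 := rfl

@[simp] theorem sz_cons (a : α) (l : List α) : sz (a :: l) = sz a + sz l + 1 := rfl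

@[simp] theorem sz_zero : sz 0 = 1 := rfl

@[simp] theorem sz_succ (n : ℕ) : sz (n + 1) = sz n + 2 := by
  change 1 + sz n + 1 = sz n + 2
  omega

@[simp] theorem sz_none : sz (none : Option α) = 1 := rfl

@[simp] theorem sz_some (a : α) : sz (some a) = sz a + 2 := rfl

theorem sz_sym (s : Γ') : sz s ≤ 11 := by
  rcases s with _ | b | _ | _ | _
  · decide
  · cases b <;> decide
  all_goals decide

theorem length_le_sz (l : List α) : l.length ≤ sz l := by
  induction l with
  | nil => simp
  | cons a l ih => simp only [List.length_cons, sz_cons]; omega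

end Size

/-! ### Elementary operations on stacks of trees -/

@[simp] theorem update_st_io (i m a b c l : List Γ') :
    update (st i m a b c) .io l = st l m a b c := by
  funext k; cases k <;> rfl

@[simp] theorem update_st_main (i m a b c l : List Γ') :
    update (st i m a b c) .main l = st i l a b c := by
  funext k; cases k <;> rfl

@[simp] theorem update_st_aux₁ (i m a b c l : List Γ') :
    update (st i m a b c) .aux₁ l = st i m l b c := by
  funext k; cases k <;> rfl

@[simp] theorem update_st_aux₂ (i m a b c l : List Γ') :
    update (st i m a b c) .aux₂ l = st i m a l c := by
  funext k; cases k <;> rfl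

@[simp] theorem update_st_cnt (i m a b c l : List Γ') :
    update (st i m a b c) .cnt l = st i m a b l := by
  funext k; cases k <;> rfl

theorem Run.cast {c : Cmd} {S S' S'' : Store} {m n : ℕ} (h : Run c S S' m) (hS : S' = S'')
    (hn : m = n) : Run c S S'' n := hS ▸ hn ▸ h

theorem Run.push_main (s : Γ') (i m a b c : List Γ') :
    Run (.push .main s) (st i m a b c) (st i (s :: m) a b c) 1 :=
  (Run.push _ _ _).cast (by simp [st]) rfl

theorem Run.pop_main (s : Γ') (i m a b c : List Γ') :
    Run (.move .main []) (st i (s :: m) a b c) (st i m a b c) 1 :=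
  (Run.move _ _ _).cast (by simp [st, pushOn]) rfl

/-- Push a word on the main stack. -/
def emit : List Γ' → Cmd
  | [] => .seq (.push .main .blank) (.move .main [])
  | s :: w => .seq (emit w) (.push .main s)

theorem run_emit (w i m a b c : List Γ') :
    Run (emit w) (st i m a b c) (st i (w ++ m) a b c) (w.length + 2) := by
  induction w with
  | nil => exact (Run.push_main _ _ _ _ _ _).seq (Run.pop_main _ _ _ _ _ _)
  | cons s w ih => exact (ih.seq (Run.push_main _ _ _ _ _ _)).cast rfl (by simp)

/-- Move the contents of a stack to another one. -/
def transfer (k k' : Stk) : Cmd := .loop k Option.isSome (.move k [k'])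

theorem run_transfer {k k' : Stk} (hk : k ≠ k') (S : Store) :
    Run (transfer k k') S (update (update S k []) k' ((S k).reverse ++ S k'))
      (3 * (S k).length + 1) := by
  generalize hl : S k = l
  induction l generalizing S with
  | nil =>
    refine (Run.loopFalse (by simp [hl])).cast ?_ rfl
    funext j
    by_cases h' : j = k'
    · subst h'; simp
    · by_cases h : j = k
      · subst h; simp [hl, h']
      · simp [h, h']
  | cons s l ih =>
    refine Run.cast (.loopTrue (by simp [hl]) (.move _ _ _) (ih _ ?_)) ?_
      (by simp only [List.length_cons, List.length_nil]; omega)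
    · simp [pushOn, hl, hk]
    · funext j
      by_cases h' : j = k'
      · subst h'; simp [pushOn, hl, hk.symm]
      · by_cases h : j = k
        · subst h; simp [h']
        · simp [pushOn, h, h']

theorem run_transfer_aux₁ (i m a b c : List Γ') :
    Run (transfer .aux₁ .main) (st i m a b c) (st i (a.reverse ++ m) [] b c)
      (3 * a.length + 1) :=
  (run_transfer (by decide) _).cast (by simp [st]) rfl

theorem run_transfer_aux₂ (i m a b c : List Γ') :
    Run (transfer .aux₂ .main) (st i m a b c) (st i (b.reverse ++ m) a [] c)
      (3 * b.length + 1) :=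
  (run_transfer (by decide) _).cast (by simp [st]) rfl

/-- The selected temporary stacks. -/
def auxes (p q : Bool) : List Stk := (if p then [.aux₁] else []) ++ (if q then [.aux₂] else [])

/-- Whether the symbol marks an inner node. -/
def isNode (o : Option Γ') : Bool := o = some (.bit true)

/-- The loop that removes a tree from the main stack while the counter tells how many subtrees are
still to come. -/
def grabLoop (p q : Bool) : Cmd :=
  .loop .cnt Option.isSome (.ite .main isNode
    (.seq (.push .cnt .blank) (.move .main (auxes p q)))
    (.seq (.move .cnt []) (.move .main (auxes p q))))

/-- Move a tree from the main stack to the selected temporary stacks. -/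
def grab (p q : Bool) : Cmd := .seq (.push .cnt .blank) (grabLoop p q)

/-- Append if the flag is set. -/
def addIf (p : Bool) (l a : List Γ') : List Γ' := if p then l ++ a else a

theorem run_move_auxes (p q : Bool) (s : Γ') (i m a b c : List Γ') :
    Run (.move .main (auxes p q)) (st i (s :: m) a b c)
      (st i m (addIf p [s] a) (addIf q [s] b) c) ((auxes p q).length + 1) := by
  refine (Run.move _ _ _).cast ?_ rfl
  cases p <;> cases q <;> simp [st, auxes, pushOn, addIf]

theorem addIf_addIf (p : Bool) (l l' a : List Γ') :
    addIf p l (addIf p l' a) = addIf p (l ++ l') a := by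
  cases p <;> simp [addIf]

/-- The counter holds one blank for each subtree still to be read: an inner node replaces one
pending subtree by two, a leaf removes one. The remainder of the loop is a hypothesis, so that the
runs for the two subtrees of a node can be chained. Each symbol costs two tests, one counter
operation, and a move that costs one more than its number of targets. -/
theorem run_grabLoop (p q : Bool) (t : BTree) (i m a b c : List Γ') (S : Store) (n : ℕ)
    (h : Run (grabLoop p q)
      (st i m (addIf p t.ser.reverse a) (addIf q t.ser.reverse b) c) S n) :
    Run (grabLoop p q) (st i (t.ser ++ m) a b (.blank :: c)) S
      (((auxes p q).length + 4) * t.size + n) := by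
  induction t generalizing m a b c n with
  | nil =>
    refine (Run.loopTrue rfl (.iteFalse (by simp [st, isNode, BTree.ser])
      (.seq ((Run.move _ _ _).cast (S'' := st i (.bit false :: m) a b c) ?_ rfl)
        (run_move_auxes p q _ _ _ _ _ _))) h).cast rfl ?_
    · simp [st, pushOn, BTree.ser]
    · simp only [BTree.size, List.length_nil]; ring
  | node x y ihx ihy =>
    have h₁ : Run (grabLoop p q) (st i (x.ser ++ (y.ser ++ m)) (addIf p [.bit true] a)
        (addIf q [.bit true] b) (.blank :: .blank :: c)) S
        (((auxes p q).length + 4) * x.size + (((auxes p q).length + 4) * y.size + n)) := by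
      refine ihx _ _ _ _ _ (ihy _ _ _ _ _ ?_)
      simpa [addIf_addIf, BTree.ser] using h
    refine (Run.loopTrue rfl (.iteTrue (by simp [st, isNode, BTree.ser])
      (.seq ((Run.push _ _ _).cast
          (S'' := st i (.bit true :: (x.ser ++ (y.ser ++ m))) a b (.blank :: .blank :: c)) ?_ rfl)
        (run_move_auxes p q _ _ _ _ _ _))) h₁).cast rfl ?_
    · simp [st, BTree.ser]
    · simp only [BTree.size]; ring

theorem run_grab (p q : Bool) (t : BTree) (i m a b : List Γ') :
    Run (grab p q) (st i (t.ser ++ m) a b [])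
      (st i m (addIf p t.ser.reverse a) (addIf q t.ser.reverse b) [])
      (((auxes p q).length + 4) * t.size + 2) :=
  (Run.seq ((Run.push _ _ _).cast (S'' := st i (t.ser ++ m) a b [.blank]) (by simp [st]) rfl)
    (run_grabLoop p q t _ _ _ _ _ _ _ (.loopFalse rfl))).cast rfl (by ring)

/-- The store that holds data only. -/
def dat (m : List Γ') : Store := st [] m [] [] []

theorem run_node (a b : BTree) (m : List Γ') :
    Run (.push .main (.bit true)) (dat (a.ser ++ (b.ser ++ m))) (dat ((BTree.node a b).ser ++ m)) 1 :=
  (Run.push_main _ _ _ _ _ _).cast (by simp [BTree.ser, dat]) rfl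

theorem run_unnode (a b : BTree) (m : List Γ') :
    Run (.move .main []) (dat ((BTree.node a b).ser ++ m)) (dat (a.ser ++ (b.ser ++ m))) 1 :=
  (Run.pop_main _ _ _ _ _ _).cast (by simp [dat]) rfl

theorem run_unnil (m : List Γ') : Run (.move .main []) (dat (BTree.nil.ser ++ m)) (dat m) 1 :=
  Run.pop_main _ _ _ _ _ _

theorem isNode_nil {t : BTree} (h : t = .nil) (m : List Γ') :
    isNode (dat (t.ser ++ m) .main).head? = false := by
  subst h
  rfl

theorem isNode_node {t a b : BTree} (h : t = .node a b) (m : List Γ') :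
    isNode (dat (t.ser ++ m) .main).head? = true := by
  subst h
  rfl

/-- Remove the top tree. -/
def dropTree : Cmd := grab false false

theorem run_dropTree (t : BTree) (m : List Γ') :
    Run dropTree (dat (t.ser ++ m)) (dat m) (4 * t.size + 2) :=
  (run_grab false false t _ _ _ _).cast rfl (by simp [auxes])

/-- Duplicate the top tree. -/
def dupTree : Cmd := .seq (grab true true) (.seq (transfer .aux₁ .main) (transfer .aux₂ .main))

theorem run_dupTree (t : BTree) (m : List Γ') :
    Run dupTree (dat (t.ser ++ m)) (dat (t.ser ++ (t.ser ++ m))) (12 * t.size + 4) := by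
  refine ((run_grab true true t _ _ _ _).seq
    ((run_transfer_aux₁ _ _ _ _ _).seq (run_transfer_aux₂ _ _ _ _ _))).cast ?_ ?_
  · simp [addIf, dat]
  · simp [addIf, auxes]; ring

/-- Exchange the two top trees. -/
def swapTree : Cmd :=
  .seq (grab true false)
    (.seq (grab false true) (.seq (transfer .aux₁ .main) (transfer .aux₂ .main)))

/-- The words are reversed on their way to the temporary stacks and again on the way back. The tree
removed first is returned first and thus ends up below. -/
theorem run_swapTree (s t : BTree) (m : List Γ') :
    Run swapTree (dat (s.ser ++ (t.ser ++ m))) (dat (t.ser ++ (s.ser ++ m)))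
      (8 * s.size + 8 * t.size + 6) := by
  refine ((run_grab true false s _ _ _ _).seq ((run_grab false true t _ _ _ _).seq
    ((run_transfer_aux₁ _ _ _ _ _).seq (run_transfer_aux₂ _ _ _ _ _)))).cast ?_ ?_
  · simp [addIf, dat]
  · simp [addIf, auxes]; ring

/-! ### Functions computable in polynomial time -/

/-- The function is computed by a program in time polynomial in the size of its argument. -/
def PT {α β : Type} [Enc α] [Enc β] (f : α → β) : Prop :=
  ∃ (c : Cmd) (P : Polynomial ℕ), ∀ a m, ∃ n ≤ P.eval (sz a),
    Run c (dat ((enc a).ser ++ m)) (dat ((enc (f a)).ser ++ m)) n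

/-- All coefficients are natural numbers, so each term is monotone. -/
theorem Polynomial.eval_nat_mono (P : Polynomial ℕ) {m n : ℕ} (h : m ≤ n) :
    P.eval m ≤ P.eval n := by
  simp only [Polynomial.eval_eq_sum_range]
  gcongr

theorem total_dat (m : List Γ') : (dat m).total = m.length := by
  have h : (Finset.univ : Finset Stk) = {.io, .main, .aux₁, .aux₂, .cnt} := rfl
  simp [Store.total, dat, h, st]

namespace PT

variable {α β γ δ ξ : Type} [Enc α] [Enc β] [Enc γ] [Enc δ] [Enc ξ]

/-- A program cannot write more symbols than it has steps. Hence values have polynomial size, which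
makes `PT` closed under composition. -/
theorem exists_bound {f : α → β} (hf : PT f) : ∃ P : Polynomial ℕ, ∀ a, sz (f a) ≤ P.eval (sz a) := by
  obtain ⟨c, P, h⟩ := hf
  refine ⟨.X + P, fun a => ?_⟩
  obtain ⟨n, hn, hr⟩ := h a []
  have := hr.total_le
  simp only [total_dat, List.append_nil, BTree.length_ser] at this
  simp only [Polynomial.eval_add, Polynomial.eval_X]
  change sz (f a) ≤ sz a + n at this
  omega

/-- The property depends on representations only. -/
theorem congr {α' β' : Type} [Enc α'] [Enc β'] {f : α → β} (hf : PT f) {g : α' → β'}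
    (e : α' → α) (he : ∀ a, enc (e a) = enc a) (hg : ∀ a, enc (g a) = enc (f (e a))) : PT g := by
  obtain ⟨c, P, h⟩ := hf
  refine ⟨c, P, fun a m => ?_⟩
  have := h (e a) m
  rw [hg a, ← he a, sz, ← he a]
  exact this

theorem comp {f : β → γ} {g : α → β} (hf : PT f) (hg : PT g) : PT fun a => f (g a) := by
  obtain ⟨Q, hQ⟩ := hg.exists_bound
  obtain ⟨c, P, hc⟩ := hf
  obtain ⟨d, R, hd⟩ := hg
  refine ⟨.seq d c, R + P.comp Q, fun a m => ?_⟩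
  obtain ⟨n₁, hn₁, h₁⟩ := hd a m
  obtain ⟨n₂, hn₂, h₂⟩ := hc (g a) m
  refine ⟨_, ?_, h₁.seq h₂⟩
  have := Polynomial.eval_nat_mono P (hQ a)
  simp only [Polynomial.eval_add, Polynomial.eval_comp]
  omega

/-- Many constructors do not change the underlying tree: consing is pairing, a successor is a pair
with the unit, `some` pairs with the unit. They therefore cost nothing beyond a dummy program. -/
theorem recode (f : α → β) (h : ∀ a, enc (f a) = enc a) : PT f := by
  -- Pushing and popping a blank replaces the missing empty program.
  refine ⟨.seq (.push .main .blank) (.move .main []), 2, fun a m => ⟨2, by simp, ?_⟩⟩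
  rw [h]
  exact (Run.push_main _ _ _ _ _ _).seq (Run.pop_main _ _ _ _ _ _)

theorem id : PT fun a : α => a := recode _ fun _ => rfl

theorem fst : PT fun p : α × β => p.1 := by
  refine ⟨.seq (.move .main []) (.seq swapTree dropTree), 12 * .X + 9, fun p m => ?_⟩
  refine ⟨_, ?_, (run_unnode _ _ _).seq ((run_swapTree _ _ _).seq (run_dropTree _ _))⟩
  simp only [sz_prod, Polynomial.eval_add, Polynomial.eval_mul, Polynomial.eval_X,
    Polynomial.eval_ofNat]
  unfold sz
  omega

theorem snd : PT fun p : α × β => p.2 := by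
  refine ⟨.seq (.move .main []) dropTree, 12 * .X + 9, fun p m => ?_⟩
  refine ⟨_, ?_, (run_unnode _ _ _).seq (run_dropTree _ _)⟩
  simp only [sz_prod, Polynomial.eval_add, Polynomial.eval_mul, Polynomial.eval_X,
    Polynomial.eval_ofNat]
  unfold sz
  omega

theorem pair {f : α → β} {g : α → γ} (hf : PT f) (hg : PT g) : PT fun a => (f a, g a) := by
  obtain ⟨Q, hQ⟩ := hg.exists_bound
  obtain ⟨c, P, hc⟩ := hf
  obtain ⟨d, R, hd⟩ := hg
  -- The second component is computed first, on the upper copy of the argument; after the exchange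
  -- the first one is computed above it, and one mark joins the two trees to a pair.
  refine ⟨.seq dupTree (.seq d (.seq swapTree (.seq c (.push .main (.bit true))))),
    20 * .X + 11 + R + 8 * Q + P, fun a m => ?_⟩
  obtain ⟨n₁, hn₁, h₁⟩ := hd a ((enc a).ser ++ m)
  obtain ⟨n₂, hn₂, h₂⟩ := hc a ((enc (g a)).ser ++ m)
  refine ⟨_, ?_, (run_dupTree _ _).seq (h₁.seq ((run_swapTree _ _ _).seq
    (h₂.seq (run_node _ _ _))))⟩
  have := hQ a
  simp only [Polynomial.eval_add, Polynomial.eval_mul, Polynomial.eval_X, Polynomial.eval_ofNat]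
  unfold sz at *
  omega

theorem const (b : β) : PT fun _ : α => b := by
  refine ⟨.seq dropTree (emit (enc b).ser), 4 * .X + 4 + .C (enc b).ser.length,
    fun a m => ⟨_, ?_, (run_dropTree _ _).seq (run_emit _ _ _ _ _ _)⟩⟩
  simp [sz]
  omega

/-- Definition by cases on whether a tree is a leaf. -/
theorem cases {τ : Type} [Enc τ] {t : α → τ} (ht : PT t) {f : α → β} (hf : PT f)
    {g : (γ × δ) × α → β} (hg : PT g) {r : α → β}
    (h : ∀ x, (enc (t x) = .nil ∧ r x = f x) ∨
      ∃ a b, enc (t x) = .node (enc a) (enc b) ∧ r x = g ((a, b), x)) : PT r := by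
  obtain ⟨Q, hQ⟩ := ht.exists_bound
  obtain ⟨c, P, hc⟩ := ht.pair id
  obtain ⟨cf, Pf, hcf⟩ := hf
  obtain ⟨cg, Pg, hcg⟩ := hg
  -- The tested tree lies above a copy of `x`. If it is a node, putting the pair mark back yields
  -- exactly the representation of `((a, b), x)`; if it is a leaf, it is popped and `x` remains.
  refine ⟨.seq c (.seq (.move .main []) (.ite .main isNode (.seq (.push .main (.bit true)) cg)
    (.seq (.move .main []) cf))), P + Pf + Pg.comp (Q + .X + 1) + 3, fun x m => ?_⟩
  obtain ⟨n, hn, hr⟩ := hc x m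
  rcases h x with ⟨h₁, h₂⟩ | ⟨a, b, h₁, h₂⟩
  · obtain ⟨n', hn', hr'⟩ := hcf x m
    rw [← h₂] at hr'
    have h₃ := run_unnil ((enc x).ser ++ m)
    rw [← h₁] at h₃
    refine ⟨_, ?_, hr.seq ((run_unnode _ _ _).seq (.iteFalse (isNode_nil h₁ _) (h₃.seq hr')))⟩
    simp only [Polynomial.eval_add, Polynomial.eval_ofNat]
    omega
  · obtain ⟨n', hn', hr'⟩ := hcg ((a, b), x) m
    rw [← h₂] at hr'
    have h₃ := run_node (enc (t x)) (enc x) m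
    rw [show BTree.node (enc (t x)) (enc x) = enc ((a, b), x) by rw [h₁]; rfl] at h₃
    refine ⟨_, ?_, hr.seq ((run_unnode _ _ _).seq (.iteTrue (isNode_node h₁ _) (h₃.seq hr')))⟩
    have : Pg.eval (sz ((a, b), x)) ≤ Pg.eval (Q.eval (sz x) + sz x + 1) := by
      refine Polynomial.eval_nat_mono _ ?_
      have := hQ x
      have h₄ : sz (t x) = sz (a, b) := by unfold sz; rw [h₁]; rfl
      rw [sz_prod]
      dsimp only
      omega
    simp only [Polynomial.eval_add, Polynomial.eval_ofNat, Polynomial.eval_comp, Polynomial.eval_X,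
      Polynomial.eval_one]
    omega

/-- The accumulators of a fold may be used if their sizes are bounded by a polynomial. -/
theorem foldl {l : ξ → List α} (hl : PT l) {b : ξ → β} (hb : PT b) {g : ξ → β → α → β}
    (hg : PT fun p : ξ × β × α => g p.1 p.2.1 p.2.2) (Q : Polynomial ℕ)
    (hQ : ∀ x l₁ l₂, l x = l₁ ++ l₂ → sz (l₁.foldl (g x) (b x)) ≤ Q.eval (sz x)) :
    PT fun x => (l x).foldl (g x) (b x) := by
  obtain ⟨R, hR⟩ := hl.exists_bound
  obtain ⟨c₁, P₁, h₁⟩ := hl.pair (hb.pair id)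
  -- The loop body acts on the rest of the list, the accumulator and the context, which is carried
  -- along unchanged.
  have hF : PT fun p : (α × List α) × (β × ξ) => (p.1.2, (g p.2.2 p.2.1 p.1.1, p.2.2)) :=
    (snd.comp fst).pair ((hg.comp ((snd.comp snd).pair ((fst.comp snd).pair (fst.comp fst)))).pair
      (snd.comp snd))
  obtain ⟨c₂, P₂, h₂⟩ := hF
  obtain ⟨c₃, P₃, h₃⟩ := fst (α := β) (β := ξ)
  -- Here `l₁` is already folded and `l₂` is still to come. The number `B` dominates the size of the
  -- argument of the body in every iteration: a suffix of the list, the accumulator, the context,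
  -- and two nodes that join them.
  have loop : ∀ (x : ξ) (m : List Γ') (B : ℕ) (l₂ l₁ : List α), l x = l₁ ++ l₂ →
      R.eval (sz x) + Q.eval (sz x) + sz x + 2 ≤ B → ∃ n ≤ l₂.length * (P₂.eval B + 3) + 2,
      Run (.seq (.loop .main isNode (.seq (.push .main (.bit true)) (.seq c₂ (.move .main []))))
          (.move .main []))
        (dat ((enc l₂).ser ++ ((enc (l₁.foldl (g x) (b x), x)).ser ++ m)))
        (dat ((enc ((l x).foldl (g x) (b x), x)).ser ++ m)) n := by
    intro x m B l₂
    induction l₂ with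
    | nil =>
      intro l₁ hx _
      rw [hx, List.append_nil]
      exact ⟨_, by simp, Run.seq (.loopFalse (isNode_nil rfl _)) (run_unnil _)⟩
    | cons a l₂ ih =>
      intro l₁ hx hB
      obtain ⟨n, hn, hr⟩ := ih (l₁ ++ [a]) (by simp [hx]) hB
      obtain ⟨n', hn', hr'⟩ := h₂ ((a, l₂), (l₁.foldl (g x) (b x), x)) m
      -- The induction hypothesis covers the loop followed by the final pop; the two are separated
      -- so that one more iteration can be put in front of the loop.
      cases hr with
      | @seq _ _ _ S' _ k₁ k₂ hr₁ hr₂ =>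
        refine ⟨_, ?_, Run.seq (.loopTrue (isNode_node rfl _) ((run_node _ _ _).seq
          (hr'.seq ((run_unnode _ _ _).cast ?_ rfl))) hr₁) hr₂⟩
        · have hsz : sz ((a, l₂), (l₁.foldl (g x) (b x), x)) ≤ B := by
            have h₄ := hQ x l₁ _ hx
            have h₅ : sz (a :: l₂) ≤ sz (l x) := by
              rw [hx]
              clear * -
              induction l₁ with
              | nil => simp
              | cons b l ih => simp only [List.cons_append, sz_cons] at ih ⊢; omega
            have h₆ := hR x
            simp only [sz_prod, sz_cons] at h₅ ⊢
            omega
          have := Polynomial.eval_nat_mono P₂ hsz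
          simp only [List.length_cons, add_mul, one_mul]
          omega
        · simp [List.foldl_append]
  refine ⟨.seq c₁ (.seq (.move .main []) (.seq (.seq (.loop .main isNode
    (.seq (.push .main (.bit true)) (.seq c₂ (.move .main [])))) (.move .main [])) c₃)),
    P₁ + 3 + R * (P₂.comp (R + Q + .X + 2) + 3) + P₃.comp (Q + .X + 1), fun x m => ?_⟩
  obtain ⟨n₁, hn₁, hr₁⟩ := h₁ x m
  obtain ⟨n₂, hn₂, hr₂⟩ := loop x m _ (l x) [] rfl le_rfl
  obtain ⟨n₃, hn₃, hr₃⟩ := h₃ ((l x).foldl (g x) (b x), x) m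
  refine ⟨_, ?_, hr₁.seq ((run_unnode _ _ _).seq (hr₂.seq hr₃))⟩
  have h₄ : P₃.eval (sz ((l x).foldl (g x) (b x), x)) ≤ P₃.eval (Q.eval (sz x) + sz x + 1) := by
    refine Polynomial.eval_nat_mono _ ?_
    have := hQ x (l x) [] (by simp)
    rw [sz_prod]
    dsimp only
    omega
  have h₅ := Nat.mul_le_mul_right (P₂.eval (R.eval (sz x) + Q.eval (sz x) + sz x + 2) + 3)
    ((length_le_sz (l x)).trans (hR x))
  simp only [Polynomial.eval_add, Polynomial.eval_ofNat, Polynomial.eval_comp, Polynomial.eval_X,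
    Polynomial.eval_one, Polynomial.eval_mul]
  omega

end PT

/-! ### Input and output -/

/-- All symbols, in the order of their indices. -/
def syms : List Γ' := [.bit false, .bit true, .comma, .bra, .ket, .blank]

theorem syms_get (s : Γ') : syms[symIndex s]? = some s := by
  rcases s with _ | b | _ | _ | _
  · rfl
  · cases b <;> rfl
  all_goals rfl

/-- Choose a program according to the top symbol of a stack. -/
def onSym (k : Stk) (f : Γ' → Cmd) : List Γ' → Cmd
  | [] => f .blank
  | s :: l => .ite k (fun o => o = some s) (f s) (onSym k f l)

theorem run_onSym {k : Stk} {f : Γ' → Cmd} {s : Γ'} {l : List Γ'} (hs : s ∈ l) {S S' : Store}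
    {n : ℕ} (hk : (S k).head? = some s) (h : Run (f s) S S' n) :
    ∃ n' ≤ n + l.length, Run (onSym k f l) S S' n' := by
  induction l with
  | nil => simp at hs
  | cons s' l ih =>
    by_cases e : s = s'
    · subst e
      exact ⟨n + 1, by simp, .iteTrue (by simp [hk]) h⟩
    · obtain ⟨n', hn', h'⟩ := ih (by simpa [e] using hs)
      exact ⟨n' + 1, by simp only [List.length_cons]; omega, .iteFalse (by simp [hk, e]) h'⟩

/-- Turn the input into a tree on the main stack. -/
def loadInput : Cmd :=
  .seq (transfer .io .aux₁) (.seq (.push .main (.bit false)) (.loop .aux₁ Option.isSome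
    (.seq (onSym .aux₁ (fun s => emit (.bit true :: (enc s).ser)) syms) (.move .aux₁ []))))

/-- A list is represented from its head, so it has to be built from its end. The word is therefore
reversed first, and then its symbols are put in front one at a time. -/
theorem run_loadInput (w : List Γ') :
    ∃ n ≤ 30 * w.length + 3, Run loadInput (st w [] [] [] []) (dat (enc w).ser) n := by
  have key : ∀ u v : List Γ', ∃ n ≤ 24 * u.length + 1, Run (.loop .aux₁ Option.isSome
      (.seq (onSym .aux₁ (fun s => emit (.bit true :: (enc s).ser)) syms) (.move .aux₁ [])))
      (st [] (enc v).ser u [] []) (dat (enc (u.reverse ++ v)).ser) n := by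
    intro u
    induction u with
    | nil => exact fun v => ⟨1, by simp, .loopFalse rfl⟩
    | cons s u ih =>
      intro v
      obtain ⟨n, hn, h⟩ := ih (s :: v)
      have hr := run_emit (.bit true :: (enc s).ser) [] (enc v).ser (s :: u) [] []
      obtain ⟨n', hn', h'⟩ := run_onSym (f := fun s => emit (.bit true :: (enc s).ser))
        (k := .aux₁) (List.mem_of_getElem? (syms_get s)) rfl hr
      refine ⟨_, ?_, .loopTrue rfl (h'.seq ((Run.move _ _ _).cast
        (S'' := st [] (enc (s :: v)).ser u [] []) ?_ rfl)) (h.cast (by simp) rfl)⟩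
      · have := sz_sym s
        simp only [sz] at this
        have hl : syms.length = 6 := rfl
        simp only [List.length_cons, List.length_nil, BTree.length_ser, hl] at hn' ⊢
        omega
      · simp [pushOn, st, enc, encListTree, BTree.ser]
  obtain ⟨n, hn, h⟩ := key w.reverse []
  refine ⟨_, ?_, ((run_transfer (by decide) _).cast (S'' := st [] [] w.reverse [] []) (by simp [st])
    rfl).seq ((Run.push_main _ _ _ _ _ _).seq (h.cast (by simp) rfl))⟩
  simp only [List.length_reverse] at hn
  simp only [st]
  omega

/-- Move the symbol that is represented on top of the main stack to a temporary stack. -/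
def readSym : List Γ' → Cmd
  | [] => .move .main []
  | s :: l => .ite .main isNode (.seq (.move .main []) (.seq (.move .main []) (readSym l)))
      (.seq (.move .main []) (.push .aux₁ s))

/-- A successor is written as `bit true`, `bit false` and its predecessor, so two pops decrease the
index while the list of candidates advances by one. -/
theorem run_readSym {l : List Γ'} {k : ℕ} {s : Γ'} (h : l[k]? = some s) (i m a b c : List Γ') :
    Run (readSym l) (st i ((enc k).ser ++ m) a b c) (st i m (s :: a) b c) (3 * k + 3) := by
  induction l generalizing k with
  | nil => simp at h
  | cons s' l ih =>
    cases k with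
    | zero =>
      obtain rfl : s' = s := by simpa using h
      exact .iteFalse rfl ((Run.pop_main _ _ _ _ _ _).seq ((Run.push _ _ _).cast (by simp [st]) rfl))
    | succ k =>
      refine (Run.iteTrue rfl ((Run.pop_main _ _ _ _ _ _).seq ((Run.pop_main _ _ _ _ _ _).seq
        (ih (k := k) (by simpa using h))))).cast rfl ?_
      ring

/-- Turn the tree on the main stack into the output. -/
def storeOutput : Cmd :=
  .seq (.loop .main isNode (.seq (.move .main []) (readSym syms)))
    (.seq (.move .main []) (transfer .aux₁ .io))

/-- The symbols are collected in reverse on a temporary stack and reversed again by the transfer.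
Symbol indices are at most 5, which bounds the cost per symbol. -/
theorem run_storeOutput (w : List Γ') :
    ∃ n ≤ 23 * w.length + 3, Run storeOutput (dat (enc w).ser) (st w [] [] [] []) n := by
  have key : ∀ w u : List Γ', ∃ n ≤ 20 * w.length + 1,
      Run (.loop .main isNode (.seq (.move .main []) (readSym syms)))
      (st [] (enc w).ser u [] []) (st [] BTree.nil.ser (w.reverse ++ u) [] []) n := by
    intro w
    induction w with
    | nil => exact fun u => ⟨1, by simp, .loopFalse rfl⟩
    | cons s w ih =>
      intro u
      obtain ⟨n, hn, h⟩ := ih (s :: u)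
      refine ⟨_, ?_, .loopTrue rfl ((Run.pop_main _ _ _ _ _ _).seq
        (run_readSym (syms_get s) _ _ _ _ _)) (h.cast (by simp) rfl)⟩
      have : symIndex s ≤ 5 := by
        rcases s with _ | b | _ | _ | _
        · decide
        · cases b <;> decide
        all_goals decide
      simp only [List.length_cons]
      omega
  obtain ⟨n, hn, h⟩ := key w []
  refine ⟨_, ?_, h.seq ((Run.pop_main _ _ _ _ _ _).seq
    ((run_transfer (by decide) _).cast (by simp [st]) rfl))⟩
  simp [st]
  omega

/-- A function is in FP if it corresponds to a polynomial time function of words. -/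
theorem PT.inFP {β γ : Type} {encIn : β → List Γ'} {encOut : γ → List Γ'} {f : β → γ}
    {F : List Γ' → List Γ'} (hF : PT F) (h : ∀ a, F (encIn a) = encOut (f a)) :
    InFP encIn encOut f := by
  obtain ⟨Q, hQ⟩ := hF.exists_bound
  obtain ⟨c, P, hc⟩ := hF
  refine inFP_of_run (.seq loadInput (.seq c storeOutput))
    (30 * .X + 6 + P.comp (12 * .X + 1) + 23 * Q.comp (12 * .X + 1)) fun a => ?_
  obtain ⟨n₁, hn₁, h₁⟩ := run_loadInput (encIn a)
  obtain ⟨n₂, hn₂, h₂⟩ := hc (encIn a) []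
  obtain ⟨n₃, hn₃, h₃⟩ := run_storeOutput (F (encIn a))
  rw [List.append_nil, List.append_nil] at h₂
  rw [h] at h₂ h₃
  refine ⟨_, ?_, h₁.seq (h₂.seq h₃)⟩
  -- Each symbol contributes its own representation, of size at most 11, and one node of the list.
  have hsz : ∀ w : List Γ', sz w ≤ 12 * w.length + 1 := by
    intro w
    induction w with
    | nil => simp
    | cons s w ih =>
      have := sz_sym s
      simp only [sz_cons, List.length_cons]
      omega
  have h₄ := Polynomial.eval_nat_mono P (hsz (encIn a))
  have h₅ := Polynomial.eval_nat_mono Q (hsz (encIn a))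
  have h₆ := length_le_sz (F (encIn a))
  have h₇ := hQ (encIn a)
  simp only [Polynomial.eval_add, Polynomial.eval_ofNat, Polynomial.eval_comp, Polynomial.eval_X,
    Polynomial.eval_one, Polynomial.eval_mul]
  omega


-- Closure properties of polynomial time functions, as rules for `fun_prop`

attribute [fun_prop] PT PT.id PT.const PT.comp

/-- Definition by cases on a list. -/
def listElim {α β : Type} (l : List α) (b : β) (f : α → List α → β) : β :=
  match l with
  | [] => b
  | a :: l => f a l

namespace PT

variable {α β γ δ ξ : Type} [Enc α] [Enc β] [Enc γ] [Enc δ] [Enc ξ]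

/-! ### Data and case distinctions -/

@[fun_prop]
theorem prodMk {f : ξ → α} {g : ξ → β} (hf : PT f) (hg : PT g) : PT fun x => (f x, g x) :=
  hf.pair hg

@[fun_prop]
theorem fst' {f : ξ → α × β} (hf : PT f) : PT fun x => (f x).1 := fst.comp hf

@[fun_prop]
theorem snd' {f : ξ → α × β} (hf : PT f) : PT fun x => (f x).2 := snd.comp hf

@[fun_prop]
theorem cons {f : ξ → α} {l : ξ → List α} (hf : PT f) (hl : PT l) : PT fun x => f x :: l x :=
  (recode (fun p : α × List α => p.1 :: p.2) fun _ => rfl).comp (hf.pair hl)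

@[fun_prop]
theorem some {f : ξ → α} (hf : PT f) : PT fun x => Option.some (f x) :=
  (recode (fun p : α × Unit => Option.some p.1) fun _ => rfl).comp (hf.pair (const ()))

@[fun_prop]
theorem succ {f : ξ → ℕ} (hf : PT f) : PT fun x => f x + 1 :=
  (recode (fun p : Unit × ℕ => p.2 + 1) fun _ => rfl).comp ((const ()).pair hf)

@[fun_prop]
theorem listElim {l : ξ → List α} (hl : PT l) {b : ξ → β} (hb : PT b) {f : ξ → α → List α → β}
    (hf : PT fun p : ξ × α × List α => f p.1 p.2.1 p.2.2) :
    PT fun x => listElim (l x) (b x) (f x) := by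
  refine cases hl hb (g := fun p : (α × List α) × ξ => f p.2 p.1.1 p.1.2)
    (hf.comp (by fun_prop : PT fun p : (α × List α) × ξ => (p.2, p.1.1, p.1.2))) fun x => ?_
  rcases h : l x with _ | ⟨a, l'⟩
  · exact .inl ⟨rfl, rfl⟩
  · exact .inr ⟨a, l', rfl, rfl⟩

@[fun_prop]
theorem optionElim {o : ξ → Option α} (ho : PT o) {b : ξ → β} (hb : PT b) {f : ξ → α → β}
    (hf : PT fun p : ξ × α => f p.1 p.2) : PT fun x => (o x).elim (b x) (f x) := by
  refine cases ho hb (g := fun p : (α × Unit) × ξ => f p.2 p.1.1)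
    (hf.comp (by fun_prop : PT fun p : (α × Unit) × ξ => (p.2, p.1.1))) fun x => ?_
  rcases h : o x with _ | a
  · exact .inl ⟨rfl, rfl⟩
  · exact .inr ⟨a, (), rfl, rfl⟩

@[fun_prop]
theorem cond {c : ξ → Bool} (hc : PT c) {f g : ξ → α} (hf : PT f) (hg : PT g) :
    PT fun x => bif c x then f x else g x := by
  refine cases hc hg (g := fun p : (Unit × Unit) × ξ => f p.2) (by fun_prop) fun x => ?_
  rcases h : c x with _ | _
  · exact .inl ⟨rfl, rfl⟩
  · exact .inr ⟨(), (), rfl, rfl⟩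

@[fun_prop]
theorem not {c : ξ → Bool} (hc : PT c) : PT fun x => !c x := by
  refine (hc.cond (const false) (const true)).congr _root_.id (fun _ => rfl) fun x => ?_
  dsimp only [_root_.id]
  cases c x <;> rfl

@[fun_prop]
theorem and {c d : ξ → Bool} (hc : PT c) (hd : PT d) : PT fun x => c x && d x := by
  refine (hc.cond hd (const false)).congr _root_.id (fun _ => rfl) fun x => ?_
  dsimp only [_root_.id]
  cases c x <;> rfl

@[fun_prop]
theorem or {c d : ξ → Bool} (hc : PT c) (hd : PT d) : PT fun x => c x || d x := by
  refine (hc.cond (const true) hd).congr _root_.id (fun _ => rfl) fun x => ?_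
  dsimp only [_root_.id]
  cases c x <;> rfl

theorem of_eq {f g : ξ → α} (hf : PT f) (h : ∀ x, g x = f x) : PT g := (funext h : g = f) ▸ hf

@[fun_prop]
theorem head? {l : ξ → List α} (hl : PT l) : PT fun x => (l x).head? :=
  (hl.listElim (const none) (f := fun _ a _ => Option.some a) (by fun_prop)).of_eq fun x => by
    cases l x <;> rfl

@[fun_prop]
theorem tail {l : ξ → List α} (hl : PT l) : PT fun x => (l x).tail :=
  (hl.listElim (const []) (f := fun _ _ l => l) (by fun_prop)).of_eq fun x => by
    cases l x <;> rfl

@[fun_prop]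
theorem isEmpty {l : ξ → List α} (hl : PT l) : PT fun x => (l x).isEmpty :=
  (hl.listElim (const true) (f := fun _ _ _ => false) (by fun_prop)).of_eq fun x => by
    cases l x <;> rfl

@[fun_prop]
theorem toList {o : ξ → Option α} (ho : PT o) : PT fun x => (o x).toList :=
  (recode (fun o : Option α => o.toList) fun o => by cases o <;> rfl).comp ho

/-- A number as a list. -/
theorem replicateUnit {n : ξ → ℕ} (hn : PT n) : PT fun x => List.replicate (n x) () :=
  (recode (fun n : ℕ => List.replicate n ()) fun n => by
    induction n with
    | zero => rfl
    | succ n ih => exact congrArg (BTree.node .nil) ih).comp hn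

/-! ### Folds -/

theorem sz_mem_le {a : α} {l : List α} (h : a ∈ l) : sz a ≤ sz l := by
  induction l with
  | nil => simp at h
  | cons b l ih =>
    rw [sz_cons]
    rcases List.mem_cons.1 h with rfl | h
    · omega
    · have := ih h
      omega

/-- A fold in which each step adds to the size only an amount that depends on the context and the
list entry. -/
theorem foldl_add {l : ξ → List α} (hl : PT l) {b : ξ → β} (hb : PT b) {g : ξ → β → α → β}
    (hg : PT fun p : ξ × β × α => g p.1 p.2.1 p.2.2) {k : ξ → α → γ}
    (hk : PT fun p : ξ × α => k p.1 p.2) (h : ∀ x b a, sz (g x b a) ≤ sz b + sz (k x a)) :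
    PT fun x => (l x).foldl (g x) (b x) := by
  obtain ⟨R, hR⟩ := hl.exists_bound
  obtain ⟨S, hS⟩ := hb.exists_bound
  obtain ⟨K, hK⟩ := hk.exists_bound
  -- `S` bounds the start value, `R` the number of steps, and `K` the growth per step, evaluated at
  -- a bound for the pair of context and list entry.
  refine hl.foldl hb hg (S + R * K.comp (.X + R + 1)) fun x l₁ l₂ hx => ?_
  have key : ∀ (l₁ : List α) (c : β), (∀ a ∈ l₁, a ∈ l x) → sz (l₁.foldl (g x) c) ≤
      sz c + l₁.length * K.eval (sz x + R.eval (sz x) + 1) := by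
    intro l₁
    induction l₁ with
    | nil => simp
    | cons a l₁ ih =>
      intro c hc
      have h₁ := ih (g x c a) fun a' ha' => hc a' (List.mem_cons_of_mem _ ha')
      have h₂ := h x c a
      have h₃ := (hK (x, a)).trans (Polynomial.eval_nat_mono K
        (n := sz x + R.eval (sz x) + 1) (by
          have := (sz_mem_le (hc a List.mem_cons_self)).trans (hR x)
          simp only [sz_prod]
          omega))
      simp only [List.foldl_cons, List.length_cons, add_mul, one_mul]
      dsimp only at h₃
      omega
  have h₁ := key l₁ (b x) fun a ha => by rw [hx]; exact List.mem_append_left _ ha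
  have h₂ := hS x
  have h₃ : l₁.length ≤ R.eval (sz x) := by
    refine le_trans ?_ ((length_le_sz (l x)).trans (hR x))
    rw [hx, List.length_append]
    omega
  have h₄ := Nat.mul_le_mul_right (K.eval (sz x + R.eval (sz x) + 1)) h₃
  simp only [Polynomial.eval_add, Polynomial.eval_mul, Polynomial.eval_comp, Polynomial.eval_X,
    Polynomial.eval_one]
  omega

/-! ### Lists -/

@[fun_prop]
theorem reverse {l : ξ → List α} (hl : PT l) : PT fun x => (l x).reverse := by
  -- Consing `a` adds `sz a + 1`; the pair `(a, ())` serves only as an object of at least this size.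
  refine (hl.foldl_add (const []) (g := fun _ acc a => a :: acc) (by fun_prop)
    (k := fun _ a => (a, ())) (by fun_prop) ?_).of_eq fun x => ?_
  · intro x b a
    simp only [sz_cons, sz_prod, sz_unit]
    omega
  · simp

@[fun_prop]
theorem append {l l' : ξ → List α} (hl : PT l) (hl' : PT l') : PT fun x => l x ++ l' x := by
  refine (hl.reverse.foldl_add hl' (g := fun _ acc a => a :: acc) (by fun_prop)
    (k := fun _ a => (a, ())) (by fun_prop) ?_).of_eq fun x => ?_
  · intro x b a
    simp only [sz_cons, sz_prod, sz_unit]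
    omega
  · simp

@[fun_prop]
theorem map {l : ξ → List α} (hl : PT l) {f : ξ → α → β} (hf : PT fun p : ξ × α => f p.1 p.2) :
    PT fun x => (l x).map (f x) := by
  refine (hl.foldl_add (const []) (g := fun x acc a => f x a :: acc) (by fun_prop)
    (k := fun x a => (f x a, ())) (by fun_prop) ?_).reverse.of_eq fun x => ?_
  · intro x b a
    simp only [sz_cons, sz_prod, sz_unit]
    omega
  · simp

@[fun_prop]
theorem filter {l : ξ → List α} (hl : PT l) {f : ξ → α → Bool}
    (hf : PT fun p : ξ × α => f p.1 p.2) : PT fun x => (l x).filter (f x) := by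
  refine (hl.foldl_add (const []) (g := fun x acc a => bif f x a then a :: acc else acc)
    (by fun_prop) (k := fun x a => (a, ())) (by fun_prop) ?_).reverse.of_eq fun x => ?_
  · intro x b a
    cases f x a
    · simp
    · simp only [cond_true, sz_cons, sz_prod, sz_unit]
      omega
  · have key : ∀ (l acc : List α),
        (l.foldl (fun acc a => bif f x a then a :: acc else acc) acc).reverse =
          acc.reverse ++ l.filter (f x) := by
      intro l
      induction l with
      | nil => simp
      | cons a l ih =>
        intro acc
        cases h : f x a <;> simp [ih, h]
    simp [key]

@[fun_prop]
theorem flatten {l : ξ → List (List α)} (hl : PT l) : PT fun x => (l x).flatten := by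
  refine (hl.foldl_add (const []) (g := fun _ acc a => acc ++ a) (by fun_prop)
    (k := fun x a => a) (by fun_prop) ?_).of_eq fun x => ?_
  · intro x b a
    induction b with
    | nil => simp
    | cons c b ih => simp only [List.cons_append, sz_cons] at ih ⊢; omega
  · have key : ∀ (l : List (List α)) (acc : List α),
        l.foldl (fun acc a => acc ++ a) acc = acc ++ l.flatten := by
      intro l
      induction l with
      | nil => simp
      | cons a l ih => simp [ih]
    simp [key]

@[fun_prop]
theorem flatMap {l : ξ → List α} (hl : PT l) {f : ξ → α → List β}
    (hf : PT fun p : ξ × α => f p.1 p.2) : PT fun x => (l x).flatMap (f x) :=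
  (hl.map hf).flatten.of_eq fun _ => List.flatMap_def

@[fun_prop]
theorem any {l : ξ → List α} (hl : PT l) {f : ξ → α → Bool}
    (hf : PT fun p : ξ × α => f p.1 p.2) : PT fun x => (l x).any (f x) :=
  ((hl.filter hf).listElim (const false) (f := fun _ _ _ => true) (const true)).of_eq fun x => by
    induction l x with
    | nil => rfl
    | cons a l ih =>
      cases h : f x a
      · simpa [h] using ih
      · simp [h, DocSpanner.listElim]

@[fun_prop]
theorem all {l : ξ → List α} (hl : PT l) {f : ξ → α → Bool}
    (hf : PT fun p : ξ × α => f p.1 p.2) : PT fun x => (l x).all (f x) :=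
  (hl.any (f := fun x a => !f x a) (by fun_prop)).not.of_eq fun x => by
    rw [List.not_any_eq_all_not]
    simp

@[fun_prop]
theorem length {l : ξ → List α} (hl : PT l) : PT fun x => (l x).length :=
  (recode (fun l : List Unit => l.length) fun l => by
    induction l with
    | nil => rfl
    | cons a l ih => exact congrArg (BTree.node .nil) ih).comp
      (hl.map (f := fun _ _ => ()) (const ())) |>.of_eq fun x => by simp

@[fun_prop]
theorem drop {l : ξ → List α} (hl : PT l) {n : ξ → ℕ} (hn : PT n) :
    PT fun x => (l x).drop (n x) := by
  refine (hn.replicateUnit.foldl_add hl (g := fun _ b _ => b.tail) (by fun_prop)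
    (k := fun _ _ => ()) (by fun_prop) ?_).of_eq fun x => ?_
  · intro x b a
    cases b
    · simp
    · simp only [List.tail_cons, sz_cons]
      omega
  · have key : ∀ (n : ℕ) (l : List α),
        l.drop n = (List.replicate n ()).foldl (fun b _ => b.tail) l := by
      intro n
      induction n with
      | zero => simp
      | succ n ih =>
        intro l
        rw [List.replicate_succ, List.foldl_cons, ← ih, List.drop_tail]
    exact key _ _

-- A prefix is obtained by dropping from the reversed list as many entries as remain behind the
-- prefix.
@[fun_prop]
theorem take {l : ξ → List α} (hl : PT l) {n : ξ → ℕ} (hn : PT n) :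
    PT fun x => (l x).take (n x) := by
  have h : PT fun x => ((l x).reverse.drop ((l x).drop (n x)).length).reverse := by fun_prop
  refine h.of_eq fun x => ?_
  rw [List.length_drop, List.reverse_drop, List.reverse_reverse, List.length_reverse]
  by_cases h : n x ≤ (l x).length
  · rw [Nat.sub_sub_self h]
  · rw [Nat.sub_eq_zero_of_le (Nat.le_of_not_le h), Nat.sub_zero, List.take_length,
      List.take_of_length_le (Nat.le_of_not_le h)]

-- Each step increments all entries and puts a zero in front. Its growth depends on the accumulator,
-- so `foldl_add` does not apply, and the general fold is used with the quadratic size of a range as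
-- bound.
@[fun_prop]
theorem range {n : ξ → ℕ} (hn : PT n) : PT fun x => List.range (n x) := by
  have key : ∀ u : List Unit, u.foldl (fun b _ => 0 :: b.map (· + 1)) [] = List.range u.length := by
    intro u
    induction u using List.reverseRecOn with
    | nil => rfl
    | append_singleton u a ih =>
      rw [List.foldl_append, ih]
      simp [List.range_succ_eq_map]
  have hsz : ∀ k m : ℕ, k ≤ m → sz (List.range k) ≤ k * (2 * m + 2) + 1 := by
    intro k m hkm
    have h₀ : ∀ j : ℕ, sz j = 2 * j + 1 := by
      intro j
      induction j with
      | zero => rfl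
      | succ j ih => rw [sz_succ, ih]; ring
    have h₁ : ∀ l : List ℕ, (∀ j ∈ l, j ≤ m) → sz l ≤ l.length * (2 * m + 2) + 1 := by
      intro l
      induction l with
      | nil => simp
      | cons j l ih =>
        intro hl
        have h₂ := ih fun i hi => hl i (List.mem_cons_of_mem _ hi)
        have h₃ := hl j List.mem_cons_self
        rw [sz_cons, h₀, List.length_cons, add_mul]
        omega
    have := h₁ (List.range k) fun j hj => by rw [List.mem_range] at hj; omega
    rwa [List.length_range] at this
  obtain ⟨P, hP⟩ := hn.exists_bound
  refine (hn.replicateUnit.foldl (const []) (g := fun _ b _ => 0 :: b.map (· + 1)) (by fun_prop)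
    (P * (2 * P + 2) + 1) ?_).of_eq fun x => by simp [key]
  intro x l₁ l₂ hx
  rw [key]
  have h₁ : l₁.length ≤ P.eval (sz x) := by
    have h₂ := congrArg List.length hx
    rw [List.length_replicate, List.length_append] at h₂
    have h₃ : n x ≤ sz (n x) := by
      generalize n x = k
      induction k with
      | zero => simp
      | succ k ih => rw [sz_succ]; omega
    have h₄ := hP x
    omega
  refine (hsz _ _ h₁).trans ?_
  simp only [Polynomial.eval_add, Polynomial.eval_mul, Polynomial.eval_ofNat, Polynomial.eval_one]
  gcongr

end PT

/-! ### Equality tests -/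

section

variable {α : Type} [DecidableEq α]

/-- Remove the first entry if it is the given one; the value `none` stands for failure. -/
def stripHead (o : Option (List α)) (a : α) : Option (List α) :=
  o.elim none fun l => listElim l none fun b l => bif decide (a = b) then some l else none

theorem foldl_stripHead_none (l : List α) : l.foldl stripHead none = none := by
  induction l with
  | nil => rfl
  | cons a l ih => exact ih

/-- This expresses equality of lists as a left fold, the form of recursion for which `PT` is
available: the entries of one list are stripped from the other one, and nothing may remain. -/
theorem foldl_stripHead (l l' : List α) :
    (l.foldl stripHead (some l')).elim false (fun r => r.isEmpty) = decide (l = l') := by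
  induction l generalizing l' with
  | nil => cases l' <;> simp
  | cons a l ih =>
    rw [List.foldl_cons]
    rcases l' with _ | ⟨b, l'⟩
    · rw [show stripHead (some []) a = none from rfl, foldl_stripHead_none]
      simp
    · by_cases h : a = b
      · rw [show stripHead (some (b :: l')) a = some l' by simp [stripHead, listElim, h], ih]
        simp [h]
      · rw [show stripHead (some (b :: l')) a = none by simp [stripHead, listElim, h],
          foldl_stripHead_none]
        simp [h]

end

/-- Types with a polynomial time equality test. -/
class EqPT (α : Type) [Enc α] [DecidableEq α] : Prop where
  decideEq : PT fun p : α × α => decide (p.1 = p.2)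

section

variable {α β ξ : Type} [Enc α] [Enc β] [Enc ξ] [DecidableEq α] [DecidableEq β]

@[fun_prop]
theorem PT.decideEq [EqPT α] {f g : ξ → α} (hf : PT f) (hg : PT g) :
    PT fun x => decide (f x = g x) :=
  EqPT.decideEq.comp (hf.pair hg)

theorem EqPT.of_injective [EqPT β] (e : α → β) (he : e.Injective) (h : PT e) : EqPT α :=
  ⟨(PT.decideEq (h.comp PT.fst) (h.comp PT.snd)).of_eq fun p => by simp [he.eq_iff]⟩

instance : EqPT Unit := ⟨(PT.const true).of_eq fun p => by simp⟩

instance : EqPT Bool :=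
  ⟨((PT.fst).cond PT.snd PT.snd.not).of_eq fun p => by rcases p with ⟨_ | _, _ | _⟩ <;> rfl⟩

instance [EqPT α] [EqPT β] : EqPT (α × β) :=
  ⟨(by fun_prop : PT fun p : (α × β) × (α × β) => decide (p.1.1 = p.2.1) && decide (p.1.2 = p.2.2)
    ).of_eq fun p => by simp [Prod.ext_iff]⟩

theorem sz_stripHead_le (o : Option (List α)) (a : α) : sz (stripHead o a) ≤ sz o := by
  rcases o with _ | _ | ⟨b, l⟩
  · exact le_rfl
  · simp [stripHead, listElim]
  · by_cases h : a = b
    · simp [stripHead, listElim, h]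
      omega
    · simp [stripHead, listElim, h]

instance [EqPT α] : EqPT (List α) := by
  have h : PT fun p : List α × List α => p.1.foldl stripHead (some p.2) :=
    PT.foldl_add (by fun_prop) (by fun_prop) (g := fun _ => stripHead) (by unfold stripHead; fun_prop)
      (k := fun _ _ => ()) (by fun_prop) fun _ b a => (sz_stripHead_le b a).trans (by simp)
  exact ⟨(by fun_prop : PT fun p : List α × List α =>
    (p.1.foldl stripHead (some p.2)).elim false (fun r => r.isEmpty)).of_eq
    fun p => (foldl_stripHead _ _).symm⟩

instance : EqPT ℕ :=
  .of_injective (fun n => List.replicate n ()) (List.replicate_left_injective _)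
    PT.id.replicateUnit

instance : EqPT Γ' :=
  .of_injective symIndex (fun s s' h => Option.some_injective _ (by
    rw [← syms_get s, ← syms_get s', h])) (PT.recode _ fun _ => rfl)

instance [EqPT α] : EqPT (Option α) :=
  .of_injective Option.toList (fun o o' h => by cases o <;> cases o' <;> simp_all) (by fun_prop)

end


/-! ### Binary arithmetic -/

/-- The number with the given binary digits, the least significant one first. -/
def binVal : List Bool → ℕ
  | [] => 0
  | b :: l => b.toNat + 2 * binVal l

theorem binVal_append (l l' : List Bool) :
    binVal (l ++ l') = binVal l + 2 ^ l.length * binVal l' := by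
  induction l with
  | nil => simp [binVal]
  | cons b l ih => simp only [List.cons_append, binVal, ih, List.length_cons]; ring

theorem binVal_encodeNat (n : ℕ) : binVal (Computability.encodeNat n) = n := by
  have h : ∀ p : PosNum, binVal (Computability.encodePosNum p) = (p : ℕ) := by
    intro p
    induction p with
    | one => rfl
    | bit0 p ih =>
      simp only [Computability.encodePosNum, binVal, ih, PosNum.cast_bit0, Bool.toNat_false]
      ring
    | bit1 p ih =>
      simp only [Computability.encodePosNum, binVal, ih, PosNum.cast_bit1, Bool.toNat_true]
      ring
  have h' : ∀ m : Num, binVal (Computability.encodeNum m) = (m : ℕ) := by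
    intro m
    cases m with
    | zero => rfl
    | pos p => exact h p
  rw [Computability.encodeNat, h']
  exact Num.to_of_nat n

/-- One step of an addition: the state holds the remaining digits of the second number, the carry,
and the digits of the sum in reverse. -/
def addStep (s : List Bool × Bool × List Bool) (x : Bool) : List Bool × Bool × List Bool :=
  (s.1.tail,
    (x && (s.1.head?.elim false fun y => y)) ||
      (s.2.1 && (x || (s.1.head?.elim false fun y => y))),
    (!decide (x = !decide ((s.1.head?.elim false fun y => y) = s.2.1))) :: s.2.2)

/-- The sum of two binary numbers. -/
def addBin (a b : List Bool) : List Bool :=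
  let s := (a ++ b.map fun _ => false).foldl addStep (b, false, [])
  s.2.2.reverse ++ [s.2.1]

/-- The invariant of column addition: the digits produced so far, plus the shifted sum of both
remainders and the carry, keep their value. The hypothesis ensures that the second number is used up
at the end; `addBin` pads the first one with zeros for this purpose. -/
theorem foldl_addStep (l : List Bool) (s : List Bool × Bool × List Bool)
    (h : s.1.length ≤ l.length) :
    binVal ((l.foldl addStep s).2.2.reverse ++ [(l.foldl addStep s).2.1]) =
      binVal s.2.2.reverse + 2 ^ s.2.2.length * (binVal s.1 + s.2.1.toNat + binVal l) := by
  induction l generalizing s with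
  | nil =>
    obtain ⟨r, c, acc⟩ := s
    obtain rfl : r = [] := by simpa using h
    simp [binVal_append, binVal]
  | cons x l ih =>
    obtain ⟨r, c, acc⟩ := s
    rw [List.foldl_cons, ih]
    · rcases r with _ | ⟨y, r⟩
      · cases x <;> cases c <;> simp [addStep, binVal_append, binVal] <;> ring
      · cases x <;> cases c <;> cases y <;> simp [addStep, binVal_append, binVal] <;> ring
    · simp only [addStep, List.length_tail]
      simp only [List.length_cons] at h
      omega

theorem binVal_replicate_false (n : ℕ) : binVal (List.replicate n false) = 0 := by
  induction n with
  | zero => rfl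
  | succ n ih => simp [List.replicate_succ, binVal, ih]

theorem binVal_addBin (a b : List Bool) : binVal (addBin a b) = binVal a + binVal b := by
  rw [addBin, foldl_addStep _ _ (by simp)]
  simp [binVal, binVal_append, binVal_replicate_false]
  ring

/-- Leading zeros are never removed. The length is nevertheless small enough to bound the
accumulators of `mulBin`. -/
theorem length_addBin (a b : List Bool) : (addBin a b).length = a.length + b.length + 1 := by
  have h : ∀ (l : List Bool) s, (l.foldl addStep s).2.2.length = s.2.2.length + l.length := by
    intro l
    induction l with
    | nil => simp
    | cons x l ih => intro s; rw [List.foldl_cons, ih]; simp [addStep]; ring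
  simp [addBin, h]

/-- The product of two binary numbers. -/
def mulBin (a b : List Bool) : List Bool :=
  a.reverse.foldl (fun acc x => addBin (bif x then b else []) (false :: acc)) []

/-- Horner's scheme, from the most significant digit of `a`: a `false` in front doubles the
accumulator. -/
theorem binVal_mulBin (a b : List Bool) : binVal (mulBin a b) = binVal a * binVal b := by
  rw [mulBin, List.foldl_reverse]
  induction a with
  | nil => simp [binVal]
  | cons x a ih =>
    rw [List.foldr_cons, binVal_addBin, binVal, ih]
    cases x <;> simp [binVal] <;> ring

/-- One step of a comparison. -/
def leStep (s : List Bool × Bool) (x : Bool) : List Bool × Bool :=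
  (s.1.tail, bif decide (x = s.1.head?.elim false fun y => y) then s.2
    else s.1.head?.elim false fun y => y)

/-- Comparison of binary numbers. -/
def leBin (a b : List Bool) : Bool :=
  ((a ++ b.map fun _ => false).foldl leStep (b, true)).2

theorem leBin_eq (a b : List Bool) : leBin a b = decide (binVal a ≤ binVal b) := by
  -- The flag `c` is the verdict on the less significant digits. Higher digits override it, so it
  -- decides only whether the comparison of the remainders is strict.
  have key : ∀ (l : List Bool) (r : List Bool) (c : Bool), r.length ≤ l.length →
      (l.foldl leStep (r, c)).2 = decide (binVal l + (!c).toNat ≤ binVal r) := by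
    intro l
    induction l with
    | nil =>
      intro r c h
      obtain rfl : r = [] := by simpa using h
      cases c <;> simp [binVal]
    | cons x l ih =>
      intro r c h
      rw [List.foldl_cons, leStep, ih]
      · rw [decide_eq_decide]
        rcases r with _ | ⟨y, r⟩
        · cases x <;> cases c <;> simp [binVal]
        · cases x <;> cases c <;> cases y <;> simp [binVal] <;> omega
      · simp only [List.length_tail]
        simp only [List.length_cons] at h
        omega
  rw [leBin, key _ _ _ (by simp)]
  simp [binVal_append, binVal_replicate_false]

section

variable {ξ : Type} [Enc ξ]

@[fun_prop]
theorem PT.addBin {a b : ξ → List Bool} (ha : PT a) (hb : PT b) :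
    PT fun x => addBin (a x) (b x) := by
  have h : PT fun x => (a x ++ (b x).map fun _ => false).foldl addStep (b x, false, []) := by
    refine PT.foldl_add (by fun_prop) (by fun_prop) (g := fun _ => addStep)
      (by unfold addStep; fun_prop) (k := fun _ _ => [true, true]) (by fun_prop) ?_
    rintro x ⟨r, c, acc⟩ y
    have h₁ : sz r.tail ≤ sz r := by
      cases r
      · exact le_rfl
      · rw [List.tail_cons, sz_cons]; omega
    have h₂ : sz [true, true] = 9 := rfl
    simp only [addStep, sz_prod, sz_cons, h₂]
    have h₃ := sz_pos c
    have h₄ := sz_bool (!decide (y = !decide ((r.head?.elim false fun y => y) = c)))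
    have h₅ := sz_bool (y && (r.head?.elim false fun y => y) ||
      c && (y || (r.head?.elim false fun y => y)))
    omega
  unfold DocSpanner.addBin
  fun_prop

@[fun_prop]
theorem PT.mulBin {a b : ξ → List Bool} (ha : PT a) (hb : PT b) :
    PT fun x => mulBin (a x) (b x) := by
  obtain ⟨P, hP⟩ := ha.exists_bound
  obtain ⟨Q, hQ⟩ := hb.exists_bound
  -- There are at most `P` steps, each adding at most `Q + 2` digits, and a digit with its list node
  -- has size at most 4.
  refine PT.foldl (l := fun x => (a x).reverse) (by fun_prop) (const []) (by fun_prop)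
    (4 * (P * (Q + 2)) + 1) fun x l₁ l₂ hx => ?_
  have h₁ : ∀ l acc : List Bool, (l.foldl (fun acc y => DocSpanner.addBin
      (bif y then b x else []) (false :: acc)) acc).length ≤
        acc.length + l.length * ((b x).length + 2) := by
    intro l
    induction l with
    | nil => simp
    | cons y l ih =>
      intro acc
      refine (ih _).trans ?_
      rw [length_addBin, List.length_cons, List.length_cons, add_mul]
      have : (bif y then b x else []).length ≤ (b x).length := by cases y <;> simp
      omega
  have h₂ : ∀ l : List Bool, sz l ≤ 4 * l.length + 1 := by
    intro l
    induction l with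
    | nil => simp
    | cons y l ih =>
      have := sz_bool y
      rw [sz_cons, List.length_cons]
      omega
  have h₃ : l₁.length ≤ P.eval (sz x) := by
    have h₄ := congrArg List.length hx
    rw [List.length_reverse, List.length_append] at h₄
    have := (length_le_sz (a x)).trans (hP x)
    omega
  have h₅ := (length_le_sz (b x)).trans (hQ x)
  refine (h₂ _).trans ?_
  simp only [Polynomial.eval_add, Polynomial.eval_mul, Polynomial.eval_ofNat, Polynomial.eval_one]
  have h₆ := h₁ l₁ []
  rw [List.length_nil, zero_add] at h₆
  gcongr
  refine h₆.trans ?_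
  gcongr

@[fun_prop]
theorem PT.leBin {a b : ξ → List Bool} (ha : PT a) (hb : PT b) :
    PT fun x => leBin (a x) (b x) := by
  have h : PT fun x => (a x ++ (b x).map fun _ => false).foldl leStep (b x, true) := by
    refine PT.foldl_add (by fun_prop) (by fun_prop) (g := fun _ => leStep)
      (by unfold leStep; fun_prop) (k := fun _ _ => [true, true]) (by fun_prop) ?_
    rintro x ⟨r, c⟩ y
    have h₁ : sz r.tail ≤ sz r := by
      cases r
      · exact le_rfl
      · rw [List.tail_cons, sz_cons]; omega
    have h₂ : sz [true, true] = 9 := rfl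
    simp only [leStep, sz_prod, h₂]
    have h₃ := sz_bool (bif decide (y = r.head?.elim false fun y => y) then c
      else r.head?.elim false fun y => y)
    omega
  unfold DocSpanner.leBin
  fun_prop

end

/-! ### Rational numbers -/

/-- Rational numbers as triples of a sign and the binary digits of numerator and denominator. -/
abbrev RatRep : Type := Bool × List Bool × List Bool

/-- The representation of a rational number. -/
def ratRep (q : ℚ) : RatRep :=
  (decide (q < 0), Computability.encodeNat q.num.natAbs, Computability.encodeNat q.den)

/-- Comparison of represented rational numbers. -/
def leRat (a b : RatRep) : Bool :=
  bif a.1 then !b.1 || leBin (mulBin b.2.1 a.2.2) (mulBin a.2.1 b.2.2)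
  else !b.1 && leBin (mulBin a.2.1 b.2.2) (mulBin b.2.1 a.2.2)

/-- Denominators are positive, so cross multiplication preserves the order. Opposite signs decide
the matter at once; for two negative numbers the comparison of absolute values is reversed. -/
theorem leRat_ratRep (p q : ℚ) : leRat (ratRep p) (ratRep q) = decide (p ≤ q) := by
  have hp : (0 : ℤ) < p.den := by exact_mod_cast p.den_pos
  have hq : (0 : ℤ) < q.den := by exact_mod_cast q.den_pos
  simp only [leRat, ratRep, leBin_eq, binVal_mulBin, binVal_encodeNat, Rat.le_iff]
  zify
  by_cases h : p < 0 <;> by_cases h' : q < 0 <;>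
    simp only [h, h', decide_true, decide_false, cond_true, cond_false, Bool.not_true,
      Bool.not_false, Bool.true_or, Bool.false_or, Bool.true_and, Bool.false_and]
  · rw [abs_of_neg (Rat.num_neg.2 h), abs_of_neg (Rat.num_neg.2 h'), decide_eq_decide]
    constructor <;> intro <;> linarith
  · symm
    have h₁ := mul_neg_of_neg_of_pos (Rat.num_neg.2 h) hq
    have h₂ := mul_nonneg (Rat.num_nonneg.2 (not_lt.1 h')) hp.le
    simpa using h₁.le.trans h₂
  · symm
    have h₁ := mul_neg_of_neg_of_pos (Rat.num_neg.2 h') hp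
    have h₂ := mul_nonneg (Rat.num_nonneg.2 (not_lt.1 h)) hq.le
    simpa using h₁.trans_le h₂
  · rw [abs_of_nonneg (Rat.num_nonneg.2 (not_lt.1 h)),
      abs_of_nonneg (Rat.num_nonneg.2 (not_lt.1 h'))]

@[fun_prop]
theorem PT.leRat {ξ : Type} [Enc ξ] {a b : ξ → RatRep} (ha : PT a) (hb : PT b) :
    PT fun x => leRat (a x) (b x) := by
  unfold DocSpanner.leRat
  fun_prop


/-! ### Parsing -/

section Many

variable {α β : Type}

/-- One step of the repeated application of a partial parser. -/
def manyStep (q : List Γ' → Option (α × List Γ')) (s : List α × List Γ') (_ : Γ') :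
    List α × List Γ' :=
  (q s.2).elim s fun r => (r.1 :: s.1, r.2)

/-- Apply a partial parser as long as possible, and skip one symbol thereafter. -/
def many (q : List Γ' → Option (α × List Γ')) (w : List Γ') : List α × List Γ' :=
  ((w.foldl (manyStep q) ([], w)).1.reverse, (w.foldl (manyStep q) ([], w)).2.tail)

/-- The fuel word only counts iterations. Once the parser fails, the state no longer changes, so
surplus fuel does no harm. -/
theorem foldl_manyStep {q : List Γ' → Option (α × List Γ')} {e : β → List Γ'} {v : β → α}
    {l : List β} (h : ∀ b ∈ l, ∀ r, q (e b ++ r) = some (v b, r)) {u : List Γ'} (hu : q u = none)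
    (fuel : List Γ') (hf : l.length ≤ fuel.length) (acc : List α) :
    fuel.foldl (manyStep q) (acc, l.flatMap e ++ u) = ((l.map v).reverse ++ acc, u) := by
  induction fuel generalizing l acc with
  | nil =>
    obtain rfl : l = [] := by simpa using hf
    simp
  | cons s fuel ih =>
    rw [List.foldl_cons]
    rcases l with _ | ⟨b, l⟩
    · rw [show manyStep q (acc, List.flatMap e [] ++ u) s = (acc, List.flatMap e [] ++ u) by
        simp [manyStep, hu]]
      exact ih (by simp) (by simp) acc
    · rw [show manyStep q (acc, List.flatMap e (b :: l) ++ u) s = (v b :: acc, l.flatMap e ++ u) by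
        simp [manyStep, h b List.mem_cons_self]]
      rw [ih (fun b hb => h b (List.mem_cons_of_mem _ hb)) (by simpa using hf)]
      simp

theorem many_eq {q : List Γ' → Option (α × List Γ')} {e : β → List Γ'} {v : β → α}
    {l : List β} (h : ∀ b ∈ l, ∀ r, q (e b ++ r) = some (v b, r)) (he : ∀ b ∈ l, e b ≠ [])
    {s : Γ'} (hs : ∀ r, q (s :: r) = none) (r : List Γ') :
    many q (l.flatMap e ++ s :: r) = (l.map v, r) := by
  -- The input serves as its own fuel: every entry occupies at least one symbol.
  have hlen : l.length ≤ (l.flatMap e ++ s :: r).length := by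
    have : l.length ≤ (l.flatMap e).length := by
      clear h
      induction l with
      | nil => simp
      | cons b l ih =>
        have h₁ := ih fun b hb => he b (List.mem_cons_of_mem _ hb)
        have h₂ := List.length_pos_iff.2 (he b List.mem_cons_self)
        simp only [List.flatMap_cons, List.length_append, List.length_cons]
        omega
    rw [List.length_append]
    omega
  rw [many, foldl_manyStep h (hs r) _ hlen]
  simp

/-- Since the remaining input never grows, each call of `q` sees at most the original size. All
parsed values thus obey one polynomial bound, which an iterated bound on `q` alone would not give.
-/
theorem PT.many [Enc α] {q : List Γ' → Option (α × List Γ')} (hq : PT q)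
    (h : ∀ w r, q w = Option.some r → sz r.2 ≤ sz w) : PT (many q) := by
  obtain ⟨K, hK⟩ := hq.exists_bound
  have key : ∀ (w fuel : List Γ') (s : List α × List Γ'), sz s.2 ≤ sz w →
      sz (fuel.foldl (manyStep q) s).2 ≤ sz w ∧
      sz (fuel.foldl (manyStep q) s).1 ≤ sz s.1 + fuel.length * K.eval (sz w) := by
    intro w fuel
    induction fuel with
    | nil => simp
    | cons a fuel ih =>
      intro s hs
      rw [List.foldl_cons]
      have h₁ := (hK s.2).trans (Polynomial.eval_nat_mono K hs)
      rcases hr : q s.2 with _ | r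
      · rw [show manyStep q s a = s by simp [manyStep, hr]]
        refine ⟨(ih s hs).1, (ih s hs).2.trans ?_⟩
        rw [List.length_cons, add_mul]
        omega
      · rw [show manyStep q s a = (r.1 :: s.1, r.2) by simp [manyStep, hr]]
        have h₂ := ih (r.1 :: s.1, r.2) ((h _ _ hr).trans hs)
        refine ⟨h₂.1, h₂.2.trans ?_⟩
        simp only [hr, sz_some, sz_prod] at h₁
        simp only [sz_cons]
        rw [List.length_cons, add_mul]
        omega
  have hfold : PT fun w : List Γ' => w.foldl (manyStep q) (([] : List α), w) := by
    refine PT.foldl (g := fun _ => manyStep q) (by fun_prop) (by fun_prop)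
      (by unfold manyStep; fun_prop) (.X * K + .X + 2) fun w l₁ l₂ hw => ?_
    have h₁ := key w l₁ ([], w) le_rfl
    have h₂ : l₁.length ≤ sz w := by
      refine le_trans ?_ (length_le_sz w)
      rw [hw, List.length_append]
      omega
    have h₃ := Nat.mul_le_mul_right (K.eval (sz w)) h₂
    simp only [Polynomial.eval_add, Polynomial.eval_mul, Polynomial.eval_ofNat, Polynomial.eval_X]
    rw [sz_prod]
    simp only [sz_nil] at h₁
    omega
  unfold DocSpanner.many
  fun_prop

theorem sz_many_le [Enc α] {q : List Γ' → Option (α × List Γ')}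
    (h : ∀ w r, q w = some r → sz r.2 ≤ sz w) (w : List Γ') : sz (many q w).2 ≤ sz w := by
  have key : ∀ (fuel : List Γ') (s : List α × List Γ'),
      sz (fuel.foldl (manyStep q) s).2 ≤ sz s.2 := by
    intro fuel
    induction fuel with
    | nil => simp
    | cons a fuel ih =>
      intro s
      rw [List.foldl_cons]
      refine (ih _).trans ?_
      rcases hr : q s.2 with _ | r
      · simp [manyStep, hr]
      · simpa [manyStep, hr] using h _ _ hr
  refine le_trans ?_ (key w ([], w))
  rw [many]
  generalize w.foldl (manyStep q) ([], w) = s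
  rcases s with ⟨_, _ | ⟨a, r⟩⟩
  · exact le_rfl
  · simp only [List.tail_cons, sz_cons]
    omega

end Many

/-- Polynomial time parsers: they return a value and the remaining input. -/
structure Parser {α : Type} [Enc α] (p : List Γ' → α × List Γ') : Prop where
  pt : PT p
  le : ∀ w, sz (p w).2 ≤ sz w

/-- Accept one symbol. -/
def markTok (s : Γ') {α : Type} (p : List Γ' → α × List Γ') (w : List Γ') :
    Option (α × List Γ') :=
  listElim w none fun a r => bif decide (a = s) then some (p r) else none

theorem sz_markTok {α : Type} (s : Γ') {p : List Γ' → α × List Γ'} (hp : ∀ w, sz (p w).2 ≤ sz w)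
    (w : List Γ') (r : α × List Γ') (h : markTok s p w = some r) : sz r.2 ≤ sz w := by
  rcases w with _ | ⟨a, w⟩
  · simp [markTok, listElim] at h
  · by_cases e : a = s
    · obtain rfl : p w = r := by simpa [markTok, listElim, e] using h
      have := hp w
      rw [sz_cons]
      omega
    · simp [markTok, listElim, e] at h

/-- Parse a number in unary. -/
def parseIndex (w : List Γ') : ℕ × List Γ' :=
  ((many (markTok (.bit true) (Prod.mk ())) w).1.length,
    (many (markTok (.bit true) (Prod.mk ())) w).2)

/-- Accept a binary digit. -/
def bitTok (w : List Γ') : Option (Bool × List Γ') :=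
  listElim w none fun a r => bif decide (a = .bit true) then some (true, r) else
    bif decide (a = .bit false) then some (false, r) else none

/-- Parse the binary digits of a number. -/
def parseBits : List Γ' → List Bool × List Γ' := many bitTok

/-- Parse a list. -/
def parseList {α : Type} (p : List Γ' → α × List Γ') : List Γ' → List α × List Γ' :=
  many (markTok .bra p)

/-- Apply two parsers one after the other. -/
def parseSeq {α β : Type} (p : List Γ' → α × List Γ') (q : List Γ' → β × List Γ')
    (w : List Γ') : (α × β) × List Γ' :=
  (((p w).1, (q (p w).2).1), (q (p w).2).2)

/-- Parse a single binary digit. -/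
def parseSign (w : List Γ') : Bool × List Γ' :=
  listElim w (false, []) fun a r => (decide (a = .bit true), r)

/-- Parse the label of a transition. -/
def parseLabel (w : List Γ') : (ℕ × ℕ) × List Γ' :=
  bif decide ((parseIndex w).1 = 0) then ((0, 0), (parseIndex w).2)
  else (((parseIndex w).1, (parseIndex (parseIndex w).2).1), (parseIndex (parseIndex w).2).2)

section

variable {α β : Type} [Enc α] [Enc β]

theorem PT.markTok (s : Γ') {p : List Γ' → α × List Γ'} (hp : PT p) : PT (markTok s p) := by
  unfold DocSpanner.markTok
  fun_prop

theorem parser_index : Parser parseIndex where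
  pt := by
    have h := PT.many (PT.markTok (.bit true) (p := Prod.mk ()) (by fun_prop))
      (sz_markTok _ fun _ => le_rfl)
    exact h.fst'.length.prodMk h.snd'
  le := sz_many_le (sz_markTok _ fun _ => le_rfl)

theorem sz_bitTok (w : List Γ') (r : Bool × List Γ') (h : bitTok w = some r) :
    sz r.2 ≤ sz w := by
  rcases w with _ | ⟨a, w⟩
  · simp [bitTok, listElim] at h
  · obtain rfl : r.2 = w := by
      by_cases e : a = .bit true
      · simp [bitTok, listElim, e] at h
        simp [← h]
      · by_cases e' : a = .bit false
        · simp [bitTok, listElim, e'] at h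
          simp [← h]
        · simp [bitTok, listElim, e, e'] at h
    rw [sz_cons]
    omega

theorem parser_bits : Parser parseBits where
  pt := PT.many (by unfold bitTok; fun_prop) sz_bitTok
  le := sz_many_le sz_bitTok

theorem Parser.list {p : List Γ' → α × List Γ'} (hp : Parser p) : Parser (parseList p) where
  pt := PT.many (PT.markTok _ hp.pt) (sz_markTok _ hp.le)
  le := sz_many_le (sz_markTok _ hp.le)

theorem Parser.seq {p : List Γ' → α × List Γ'} (hp : Parser p) {q : List Γ' → β × List Γ'}
    (hq : Parser q) : Parser (parseSeq p q) where
  pt := by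
    have h₁ := hp.pt
    have h₂ := hq.pt
    unfold parseSeq
    fun_prop
  le w := (hq.le _).trans (hp.le w)

theorem parser_sign : Parser parseSign where
  pt := by unfold parseSign; fun_prop
  le w := by
    rcases w with _ | ⟨a, w⟩
    · exact le_rfl
    · simp only [parseSign, listElim, sz_cons]
      omega

theorem parser_label : Parser parseLabel where
  pt := by
    have h := parser_index.pt
    unfold parseLabel
    generalize parseIndex = p at h ⊢
    fun_prop
  le w := by
    unfold parseLabel
    cases decide ((parseIndex w).1 = 0)
    · exact (parser_index.le _).trans (parser_index.le w)
    · exact parser_index.le w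

end

/-! ### Parsing instances -/

theorem parseIndex_eq (n : ℕ) (r : List Γ') : parseIndex (encIndex n ++ r) = (n, r) := by
  have h := many_eq (q := markTok (.bit true) (Prod.mk ())) (e := fun _ : Unit => [.bit true])
    (v := fun _ => ()) (l := List.replicate n ()) (fun _ _ _ => rfl) (by simp) (s := .comma)
    (fun _ => rfl) r
  have e : encIndex n ++ r = (List.replicate n ()).flatMap (fun _ => [Γ'.bit true]) ++ .comma :: r := by
    rw [encIndex, List.append_assoc]
    congr 1
    clear h
    induction n with
    | zero => rfl
    | succ n ih => simp [List.replicate_succ, ih]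
  rw [parseIndex, e, h]
  simp

theorem parseBits_eq (n : ℕ) (r : List Γ') :
    parseBits (encBinary n ++ r) = (Computability.encodeNat n, r) := by
  have h := many_eq (q := bitTok) (e := fun b : Bool => [.bit b]) (v := fun b => b)
    (l := Computability.encodeNat n) (fun b _ _ => by cases b <;> rfl) (by simp) (s := .comma)
    (fun _ => rfl) r
  rw [List.map_id'] at h
  rw [parseBits, ← h, encBinary, List.append_assoc, List.map_eq_flatMap]
  rfl

/-- The mark in front of each entry tells whether another one follows, so the parser of entries need
not be able to fail. -/
theorem parseList_eq {α β : Type} {p : List Γ' → α × List Γ'} {e : β → List Γ'} {v : β → α}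
    {l : List β} (h : ∀ b ∈ l, ∀ r, p (e b ++ r) = (v b, r)) (r : List Γ') :
    parseList p (encList e l ++ r) = (l.map v, r) := by
  have h := many_eq (q := markTok .bra p) (e := fun b => Γ'.bra :: e b) (v := v) (l := l)
    (fun b hb r => by simp [markTok, listElim, h b hb]) (by simp) (s := .ket) (fun _ => rfl) r
  rw [parseList, ← h, encList, List.append_assoc]
  rfl

theorem parseSeq_eq {α β : Type} {p : List Γ' → α × List Γ'} {q : List Γ' → β × List Γ'}
    {u v r : List Γ'} {a : α} {b : β} (hp : p (u ++ (v ++ r)) = (a, v ++ r))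
    (hq : q (v ++ r) = (b, r)) : parseSeq p q (u ++ (v ++ r)) = ((a, b), r) := by
  simp [parseSeq, hp, hq]

/-- Parse the representation of a rational number. -/
def parseRat : List Γ' → RatRep × List Γ' := parseSeq parseSign (parseSeq parseBits parseBits)

theorem parseRat_eq (q : ℚ) (r : List Γ') : parseRat (encRat q ++ r) = (ratRep q, r) := by
  have h : encRat q ++ r = [Γ'.bit (decide (q < 0))] ++ ((encBinary q.num.natAbs ++
      encBinary q.den) ++ r) := rfl
  rw [h]
  refine parseSeq_eq ?_ ?_
  · by_cases h : q < 0 <;> simp [parseSign, listElim, h]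
  · rw [List.append_assoc]
    exact parseSeq_eq (parseBits_eq _ _) (parseBits_eq _ _)

/-- The kind and the argument of a transition label. -/
def labelRep {s k : ℕ} : Option (RefLetter (Fin s) (Fin k)) → ℕ × ℕ
  | none => (0, 0)
  | some (.sym a) => (1, a)
  | some (.vopen x) => (2, x)
  | some (.vclose x) => (3, x)

theorem parseLabel_eq {s k : ℕ} (o : Option (RefLetter (Fin s) (Fin k))) (r : List Γ') :
    parseLabel (encLabel o ++ r) = (labelRep o, r) := by
  rcases o with _ | a | x | x <;>
    simp [encLabel, parseLabel, labelRep, parseIndex_eq, List.append_assoc]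

/-- A transition of an automaton: source, kind and argument of its label, target. -/
abbrev TransRep : Type := ℕ × (ℕ × ℕ) × ℕ

/-- A row of the table. -/
abbrev RowRep : Type := List (List ℕ) × RatRep

/-- Instances as data: the numbers of letters, variables and states, the initial states, the
accepting states, the transitions, the document, the variables of the weight function, and its
table. -/
abbrev InstRep : Type :=
  ℕ × ℕ × ℕ × List ℕ × List ℕ × List TransRep × List ℕ × List ℕ × List RowRep

/-- Parse an instance. -/
def parseInst : List Γ' → InstRep × List Γ' :=
  parseSeq parseIndex <| parseSeq parseIndex <| parseSeq parseIndex <|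
  parseSeq (parseList parseIndex) <| parseSeq (parseList parseIndex) <|
  parseSeq (parseList (parseSeq parseIndex (parseSeq parseLabel parseIndex))) <|
  parseSeq (parseList parseIndex) <| parseSeq (parseList parseIndex) <|
  parseList (parseSeq (parseList (parseList parseIndex)) parseRat)

theorem parser_inst : Parser parseInst :=
  parser_index.seq <| parser_index.seq <| parser_index.seq <|
  parser_index.list.seq <| parser_index.list.seq <|
  (parser_index.seq (parser_label.seq parser_index)).list.seq <|
  parser_index.list.seq <| parser_index.list.seq <|
  (parser_index.list.list.seq (parser_sign.seq (parser_bits.seq parser_bits))).list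

/-- A string as data. -/
def strRep {s : ℕ} (w : List (Fin s)) : List ℕ := w.map Fin.val

/-- The transitions of an automaton. -/
def transList {s k n : ℕ} (A : VSA (Fin s) (Fin k) (Fin n)) :
    List (Fin n × Option (RefLetter (Fin s) (Fin k)) × Fin n) :=
  (List.finRange n ×ˢ (allLabels s k ×ˢ List.finRange n)).filter fun e => A.delta e.1 e.2.1 e.2.2

/-- An instance as data. -/
def instRep {c : ℕ} (I : Instance c) : InstRep :=
  (I.numSyms, I.numVars, I.numStates,
    ((List.finRange I.numStates).filter I.aut.init).map Fin.val,
    ((List.finRange I.numStates).filter I.aut.final).map Fin.val,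
    (transList I.aut).map fun e => ((e.1 : ℕ), labelRep e.2.1, (e.2.2 : ℕ)),
    strRep I.document, (List.ofFn I.X).map Fin.val,
    I.rows.map fun row => ((List.ofFn row.1).map strRep, ratRep row.2))

theorem parseInst_eq {c : ℕ} (I : Instance c) :
    parseInst (encInstance I) = (instRep I, []) := by
  have hidx : ∀ {n : ℕ} (l : List (Fin n)) (r : List Γ'),
      parseList parseIndex (encList (fun q : Fin n => encIndex q) l ++ r) =
        (l.map Fin.val, r) :=
    fun l r => parseList_eq (fun _ _ _ => parseIndex_eq _ _) r
  have htr := parseList_eq (l := transList I.aut) (p := parseSeq parseIndex (parseSeq parseLabel parseIndex))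
    (e := fun e => encIndex e.1 ++ encLabel e.2.1 ++ encIndex e.2.2)
    (v := fun e => ((e.1 : ℕ), labelRep e.2.1, (e.2.2 : ℕ)))
    (fun e _ r => by
      simp only [List.append_assoc]
      have h₂ := parseSeq_eq (parseLabel_eq e.2.1 (encIndex e.2.2 ++ r)) (parseIndex_eq e.2.2 r)
      rw [← List.append_assoc (encLabel e.2.1)] at h₂ ⊢
      exact parseSeq_eq (parseIndex_eq _ _) h₂)
  have hrow := parseList_eq (l := I.rows) (p := parseSeq (parseList (parseList parseIndex)) parseRat)
    (e := fun row => encList encString (List.ofFn row.1) ++ encRat row.2)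
    (v := fun row => ((List.ofFn row.1).map strRep, ratRep row.2))
    (fun row _ r => by
      rw [List.append_assoc]
      exact parseSeq_eq (parseList_eq (fun _ _ _ => hidx _ _) _) (parseRat_eq _ _))
  have hr := hrow []
  simp only [transList, List.append_assoc] at htr
  simp only [encInstance, encVSA, encString, List.append_assoc]
  rw [← List.append_nil (encList _ I.rows)]
  simp only [parseInst, parseSeq, parseIndex_eq, hidx, htr, hr]
  rfl


/-! ### The algorithm -/

/-- An assignment of spans to variables: entries consist of a variable and the numbers of letters
before the beginning and before the end of its span. -/
abbrev Asg : Type := List (ℕ × ℕ × ℕ)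

/-- All assignments for at most `c` variables. -/
def assigns : ℕ → List ℕ → List ℕ → List Asg
  | 0, _, _ => [[]]
  | c + 1, pos, X => listElim X [[]] fun x X =>
      pos.flatMap fun i => pos.flatMap fun j => (assigns c pos X).map fun a => (x, i, j) :: a

/-- Whether the transition `t` leads from the first configuration, that is, a state and a position
in the document, to the second one in accordance with the assignment. -/
def stepOK (asg : Asg) (d : List ℕ) (t : TransRep) (u v : ℕ × ℕ) : Bool :=
  decide (u.1 = t.1) && (decide (v.1 = t.2.2) &&
    bif decide (t.2.1.1 = 1) then
      decide (v.2 = u.2 + 1) && decide ((d.drop u.2).head? = some t.2.1.2)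
    else decide (v.2 = u.2) &&
      bif decide (t.2.1.1 = 2) then asg.all fun e => !decide (e.1 = t.2.1.2) || decide (e.2.1 = u.2)
      else bif decide (t.2.1.1 = 3) then
        asg.all fun e => !decide (e.1 = t.2.1.2) || decide (e.2.2 = u.2)
      else true)

/-- All configurations. -/
def configs (n : ℕ) (d : List ℕ) : List (ℕ × ℕ) :=
  (List.range n).flatMap fun q => (List.range (d.length + 1)).map fun p => (q, p)

/-- The vertices that are in a set or reachable from it by an edge. -/
def expand {ν : Type} [DecidableEq ν] (N : List ν) (edge : ν → ν → Bool) (R : List ν) : List ν :=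
  N.filter fun v => R.any (fun u => decide (u = v)) || R.any fun u => edge u v

/-- The vertices that are reachable from a set. -/
def reachList {ν : Type} [DecidableEq ν] (N : List ν) (edge : ν → ν → Bool) (R : List ν) :
    List ν :=
  N.foldl (fun R _ => expand N edge R) R

/-- Whether the automaton accepts the document in accordance with the assignment. -/
def acceptsAsg (I : InstRep) (asg : Asg) : Bool :=
  (reachList (configs I.2.2.1 I.2.2.2.2.2.2.1)
    (fun u v => I.2.2.2.2.2.1.any fun t => stepOK asg I.2.2.2.2.2.2.1 t u v)
    ((configs I.2.2.1 I.2.2.2.2.2.2.1).filter fun v =>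
      I.2.2.2.1.any (fun q => decide (q = v.1)) && decide (v.2 = 0))).any
    fun v => I.2.2.2.2.1.any (fun q => decide (q = v.1)) &&
      decide (v.2 = I.2.2.2.2.2.2.1.length)

/-- The weight of the tuples that extend the assignment. -/
def weightAsg (I : InstRep) (asg : Asg) : RatRep :=
  (I.2.2.2.2.2.2.2.2.filter fun row => decide (row.1 =
    asg.map fun e => (I.2.2.2.2.2.2.1.take e.2.2).drop e.2.1)).head?.elim (ratRep 0) fun row => row.2

/-- The weights of all extracted tuples. -/
def weights (c : ℕ) (I : InstRep) : List RatRep :=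
  ((assigns c (List.range (I.2.2.2.2.2.2.1.length + 1)) I.2.2.2.2.2.2.2.1).filter fun asg =>
    acceptsAsg I asg).map fun asg => weightAsg I asg

/-- A best entry of a list. -/
def bestOf {α : Type} (le : α → α → Bool) (l : List α) : Option α :=
  l.foldl (fun o a => o.elim (some a) fun b => bif le a b then some a else some b) none

/-- The output for a result. -/
def outRep (o : Option RatRep) : List Γ' :=
  o.elim [] fun q => Γ'.bit q.1 ::
    ((q.2.1.map Γ'.bit ++ [Γ'.comma]) ++ (q.2.2.map Γ'.bit ++ [Γ'.comma]))

section

variable {ξ : Type} [Enc ξ]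

-- As `c` is fixed, the recursion can be unfolded by an induction outside the programs, each level
-- nesting two iterations over the positions. The context grows with every level, hence the
-- generalization over `ξ`. The degree of the resulting polynomial depends on `c`.
@[fun_prop]
theorem PT.assigns (c : ℕ) {pos X : ξ → List ℕ} (hp : PT pos) (hX : PT X) :
    PT fun x => assigns c (pos x) (X x) := by
  induction c generalizing ξ with
  | zero => exact const _
  | succ c ih =>
    have h : PT fun p : ((ξ × ℕ × List ℕ) × ℕ) × ℕ =>
        DocSpanner.assigns c (pos p.1.1.1) p.1.1.2.2 :=
      ih (hp.comp (by fun_prop)) (by fun_prop)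
    unfold DocSpanner.assigns
    fun_prop

@[fun_prop]
theorem PT.stepOK {asg : ξ → Asg} {d : ξ → List ℕ} {t : ξ → TransRep} {u v : ξ → ℕ × ℕ}
    (hasg : PT asg) (hd : PT d) (ht : PT t) (hu : PT u) (hv : PT v) :
    PT fun x => stepOK (asg x) (d x) (t x) (u x) (v x) := by
  unfold DocSpanner.stepOK
  fun_prop

@[fun_prop]
theorem PT.configs {n : ξ → ℕ} {d : ξ → List ℕ} (hn : PT n) (hd : PT d) :
    PT fun x => configs (n x) (d x) := by
  unfold DocSpanner.configs
  fun_prop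

theorem PT.sz_filter_le {α : Type} [Enc α] (f : α → Bool) (l : List α) :
    sz (l.filter f) ≤ sz l := by
  induction l with
  | nil => exact le_rfl
  | cons a l ih =>
    cases h : f a
    · simp only [h, sz_cons, List.filter_cons, Bool.false_eq_true, if_false]
      omega
    · simp only [h, sz_cons, List.filter_cons, if_true]
      omega

/-- After at least one round the accumulator is a filtered copy of `N`, and before that it is `R`;
so its size never exceeds the sum of both bounds. -/
theorem PT.reachList {ν : Type} [Enc ν] [DecidableEq ν] [EqPT ν] {N : ξ → List ν}
    {edge : ξ → ν → ν → Bool} {R : ξ → List ν} (hN : PT N)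
    (hedge : PT fun p : ξ × ν × ν => edge p.1 p.2.1 p.2.2) (hR : PT R) :
    PT fun x => reachList (N x) (edge x) (R x) := by
  obtain ⟨P, hP⟩ := hN.exists_bound
  obtain ⟨Q, hQ⟩ := hR.exists_bound
  have h : PT fun p : (((ξ × List ν × ν) × ν) × ν) => edge p.1.1.1 p.2 p.1.2 :=
    hedge.comp (g := fun p : (((ξ × List ν × ν) × ν) × ν) => (p.1.1.1, p.2, p.1.2)) (by fun_prop)
  refine hN.foldl hR (g := fun x R _ => expand (N x) (edge x) R) (by unfold expand; fun_prop)
    (P + Q) fun x l₁ l₂ hx => ?_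
  have h₁ := hP x
  have h₂ := hQ x
  rw [Polynomial.eval_add]
  rcases List.eq_nil_or_concat l₁ with rfl | ⟨l, v, rfl⟩
  · rw [List.foldl_nil]
    omega
  · rw [List.concat_eq_append, List.foldl_append]
    refine le_trans (PT.sz_filter_le _ _) ?_
    omega

theorem pt_acceptsAsg : PT fun p : InstRep × Asg => acceptsAsg p.1 p.2 := by
  have h := PT.reachList (ξ := InstRep × Asg)
    (N := fun p => configs p.1.2.2.1 p.1.2.2.2.2.2.2.1)
    (edge := fun p u v => p.1.2.2.2.2.2.1.any fun t => stepOK p.2 p.1.2.2.2.2.2.2.1 t u v)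
    (R := fun p => (configs p.1.2.2.1 p.1.2.2.2.2.2.2.1).filter fun v =>
      p.1.2.2.2.1.any (fun q => decide (q = v.1)) && decide (v.2 = 0))
    (by fun_prop) (by fun_prop) (by fun_prop)
  unfold acceptsAsg
  exact h.any (f := fun p v => p.1.2.2.2.2.1.any (fun q => decide (q = v.1)) &&
      decide (v.2 = p.1.2.2.2.2.2.2.1.length)) (by fun_prop)

theorem pt_weightAsg : PT fun p : InstRep × Asg => weightAsg p.1 p.2 := by
  unfold weightAsg
  fun_prop

theorem pt_weights (c : ℕ) : PT (weights c) :=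
  PT.map (PT.filter (by fun_prop) pt_acceptsAsg) pt_weightAsg

theorem pt_bestOf {α : Type} [Enc α] {le : α → α → Bool} (h : PT fun p : α × α => le p.1 p.2) :
    PT (bestOf le) := by
  have h' : PT fun p : (List α × Option α × α) × α => le p.1.2.2 p.2 :=
    h.comp (g := fun p : (List α × Option α × α) × α => (p.1.2.2, p.2)) (by fun_prop)
  refine PT.foldl_add PT.id (PT.const none) (g := fun _ o a =>
    o.elim (some a) fun b => bif le a b then some a else some b) (by fun_prop)
    (k := fun _ a => some a) (by fun_prop) ?_
  rintro x (_ | b) a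
  · simp
  · have h₁ := sz_pos a
    cases h₂ : le a b <;> simp [h₂]

theorem pt_outRep : PT outRep := by
  have h : PT Γ'.bit := PT.recode _ fun b => by cases b <;> rfl
  unfold outRep
  fun_prop

/-- The algorithm on words. -/
def aggWord (c : ℕ) (le : RatRep → RatRep → Bool) (w : List Γ') : List Γ' :=
  outRep (bestOf le (weights c (parseInst w).1))

theorem pt_aggWord (c : ℕ) {le : RatRep → RatRep → Bool}
    (h : PT fun p : RatRep × RatRep => le p.1 p.2) : PT (aggWord c le) :=
  pt_outRep.comp ((pt_bestOf h).comp ((pt_weights c).comp parser_inst.pt.fst'))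

end


/-! ### Reachability -/

section Reach

variable {ν : Type} [DecidableEq ν] {N R : List ν} {edge : ν → ν → Bool}

theorem mem_expand {v : ν} :
    v ∈ expand N edge R ↔ v ∈ N ∧ (v ∈ R ∨ ∃ u ∈ R, edge u v = true) := by
  simp [expand]

theorem reachList_eq_iterate (N' : List ν) :
    N'.foldl (fun R _ => expand N edge R) R = (expand N edge)^[N'.length] R := by
  induction N' generalizing R with
  | nil => rfl
  | cons a l ih => rw [List.foldl_cons, ih]; rfl

/-- A round applied to a set that is not closed under edges adds a new vertex. After as many rounds
as `N` has entries, the set is therefore closed or exhausts `N`, which is closed by `hN`. -/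
theorem mem_reachList (hR : R ⊆ N) (hN : ∀ u ∈ N, ∀ v, edge u v = true → v ∈ N) {v : ν} :
    v ∈ reachList N edge R ↔ ∃ u ∈ R, Relation.ReflTransGen (fun u v => edge u v = true) u v := by
  rw [reachList, reachList_eq_iterate]
  have hsub : ∀ k, (expand N edge)^[k] R ⊆ N ∧ R ⊆ (expand N edge)^[k] R := by
    intro k
    induction k with
    | zero => exact ⟨hR, fun _ h => h⟩
    | succ k ih =>
      rw [Function.iterate_succ_apply']
      exact ⟨fun v hv => (mem_expand.1 hv).1, fun v hv => mem_expand.2 ⟨hR hv, .inl (ih.2 hv)⟩⟩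
  constructor
  · have key : ∀ k v, v ∈ (expand N edge)^[k] R →
        ∃ u ∈ R, Relation.ReflTransGen (fun u v => edge u v = true) u v := by
      intro k
      induction k with
      | zero => exact fun v hv => ⟨v, hv, .refl⟩
      | succ k ih =>
        intro v hv
        rw [Function.iterate_succ_apply', mem_expand] at hv
        rcases hv.2 with hv | ⟨w, hw, e⟩
        · exact ih v hv
        · obtain ⟨u, hu, h⟩ := ih w hw
          exact ⟨u, hu, h.tail e⟩
    exact key _ v
  · have key : ∀ k, (∀ u ∈ (expand N edge)^[k] R, ∀ v, edge u v = true →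
        v ∈ (expand N edge)^[k] R) ∨ k ≤ ((expand N edge)^[k] R).toFinset.card := by
      intro k
      induction k with
      | zero => exact .inr (Nat.zero_le _)
      | succ k ih =>
        rw [Function.iterate_succ_apply']
        have h₀ := (hsub k).1
        generalize (expand N edge)^[k] R = S at ih h₀
        by_cases hc : ∀ u ∈ S, ∀ v, edge u v = true → v ∈ S
        · left
          intro u hu v e
          have hu' : u ∈ S := by
            rcases (mem_expand.1 hu).2 with h | ⟨w, hw, e⟩
            exacts [h, hc w hw u e]
          exact mem_expand.2 ⟨h₀ (hc u hu' v e), .inl (hc u hu' v e)⟩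
        · right
          refine Nat.succ_le_of_lt ((ih.resolve_left hc).trans_lt (Finset.card_lt_card ?_))
          push Not at hc
          obtain ⟨u, hu, v, e, hv⟩ := hc
          rw [Finset.ssubset_iff_of_subset]
          · exact ⟨v, by simpa using mem_expand.2 ⟨hN u (h₀ hu) v e, .inr ⟨u, hu, e⟩⟩, by simpa⟩
          · intro w hw
            rw [List.mem_toFinset] at hw ⊢
            exact mem_expand.2 ⟨h₀ hw, .inl hw⟩
    have hclosed : ∀ u ∈ (expand N edge)^[N.length] R, ∀ v, edge u v = true →
        v ∈ (expand N edge)^[N.length] R := by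
      rcases key N.length with h | h
      · exact h
      · have h₁ : ((expand N edge)^[N.length] R).toFinset ⊆ N.toFinset := fun v hv => by
          rw [List.mem_toFinset] at hv ⊢
          exact (hsub _).1 hv
        have h₂ := Finset.eq_of_subset_of_card_le h₁ ((List.toFinset_card_le N).trans h)
        intro u hu v e
        have h₃ := hN u ((hsub _).1 hu) v e
        rwa [← List.mem_toFinset, ← h₂, List.mem_toFinset] at h₃
    rintro ⟨u, hu, h⟩
    induction h with
    | refl => exact (hsub _).2 hu
    | tail _ e ih => exact hclosed _ ih _ e

end Reach

/-! ### Runs that respect an assignment -/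

/-- The operations in the ref-word are at the positions that the assignment prescribes. -/
def Respects {α : Type} {k : ℕ} (asg : Asg) (p : ℕ) (r : List (RefLetter α (Fin k))) : Prop :=
  ∀ pre post, ∀ x : Fin k,
    (r = pre ++ .vopen x :: post → ∀ e ∈ asg, e.1 = x → e.2.1 = p + (doc pre).length) ∧
    (r = pre ++ .vclose x :: post → ∀ e ∈ asg, e.1 = x → e.2.2 = p + (doc pre).length)

/-- A move from one position to another with the given label. -/
def MoveOK {α : Type} {k : ℕ} (asg : Asg) (d : List α) : Option (RefLetter α (Fin k)) → ℕ → ℕ → Prop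
  | none, p, p' => p' = p
  | some (.sym a), p, p' => p' = p + 1 ∧ d[p]? = some a
  | some (.vopen x), p, p' => p' = p ∧ ∀ e ∈ asg, e.1 = x → e.2.1 = p
  | some (.vclose x), p, p' => p' = p ∧ ∀ e ∈ asg, e.1 = x → e.2.2 = p

/-- A sequence of labels leads from a position to the end of the document. -/
def Fits {α : Type} {k : ℕ} (asg : Asg) (d : List α) : List (Option (RefLetter α (Fin k))) → ℕ → Prop
  | [], p => p = d.length
  | o :: w, p => ∃ p', MoveOK asg d o p p' ∧ Fits asg d w p'

section Fits

variable {α : Type} {k : ℕ} {asg : Asg}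

theorem doc_cons (l : RefLetter α (Fin k)) (r : List (RefLetter α (Fin k))) :
    doc (l :: r) = doc [l] ++ doc r := by
  cases l <;> rfl

/-- This replaces the quantification over all factorizations by a recursion along the word, parallel
to that of `Fits`. -/
theorem respects_cons (p : ℕ) (l : RefLetter α (Fin k)) (r : List (RefLetter α (Fin k))) :
    Respects asg p (l :: r) ↔
      (∀ x, (l = .vopen x → ∀ e ∈ asg, e.1 = x → e.2.1 = p) ∧
        (l = .vclose x → ∀ e ∈ asg, e.1 = x → e.2.2 = p)) ∧
      Respects asg (p + (doc [l]).length) r := by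
  constructor
  · intro h
    refine ⟨fun x => ⟨?_, ?_⟩, fun pre post x => ⟨?_, ?_⟩⟩
    · rintro rfl
      exact (h [] r x).1 rfl
    · rintro rfl
      exact (h [] r x).2 rfl
    · rintro rfl
      have := (h (l :: pre) post x).1 rfl
      rwa [doc_cons, List.length_append, ← add_assoc] at this
    · rintro rfl
      have := (h (l :: pre) post x).2 rfl
      rwa [doc_cons, List.length_append, ← add_assoc] at this
  · rintro ⟨h₁, h₂⟩ (_ | ⟨l', pre⟩) post x
    · refine ⟨fun h => ?_, fun h => ?_⟩ <;> obtain ⟨rfl, rfl⟩ := List.cons.inj h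
      · exact (h₁ x).1 rfl
      · exact (h₁ x).2 rfl
    · refine ⟨fun h => ?_, fun h => ?_⟩ <;> obtain ⟨rfl, rfl⟩ := List.cons.inj h <;>
        rw [doc_cons, List.length_append, ← add_assoc]
      · exact (h₂ pre post x).1 rfl
      · exact (h₂ pre post x).2 rfl

/-- The link between local moves through the document and the ref-word that remains after removing
the `ε`-labels. The bound on `p` is essential: beyond the end, `drop` would still return the empty
word. -/
theorem fits_iff (d : List α) (w : List (Option (RefLetter α (Fin k)))) (p : ℕ) (hp : p ≤ d.length) :
    Fits asg d w p ↔ doc w.reduceOption = d.drop p ∧ Respects asg p w.reduceOption := by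
  induction w generalizing p with
  | nil =>
    have h : Respects asg p ([] : List (RefLetter α (Fin k))) := by
      intro pre post x
      constructor <;> intro h <;> simp at h
    simp only [Fits, List.reduceOption_nil, h, and_true]
    constructor
    · rintro rfl
      simp [doc]
    · intro h
      have := congrArg List.length h
      simp only [doc, List.filterMap_nil, List.length_nil, List.length_drop] at this
      omega
  | cons o w ih =>
    rcases o with _ | a | x | x
    · rw [List.reduceOption_cons_of_none, ← ih p hp]
      simp [Fits, MoveOK]
    · rw [List.reduceOption_cons_of_some, respects_cons, doc_cons]
      simp only [Fits, MoveOK, doc, List.filterMap_cons, List.filterMap_nil, List.length_singleton,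
        reduceCtorEq, false_imp_iff, implies_true, true_and, and_self, List.singleton_append,
        and_assoc, exists_eq_left]
      by_cases hlt : p < d.length
      · rw [List.getElem?_eq_getElem hlt, List.drop_eq_getElem_cons hlt, List.cons.injEq, ih _ hlt,
          Option.some.injEq, and_assoc, eq_comm]
        rfl
      · rw [List.getElem?_eq_none (not_lt.1 hlt), List.drop_eq_nil_of_le (not_lt.1 hlt)]
        simp
    · rw [List.reduceOption_cons_of_some, respects_cons, doc_cons]
      have h := ih p hp
      simp only [Fits, MoveOK, and_assoc, exists_eq_left, h]
      simp only [doc, List.filterMap_cons, List.filterMap_nil, List.length_nil,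
        reduceCtorEq, false_imp_iff, and_true, List.nil_append, add_zero, RefLetter.vopen.injEq]
      constructor
      · rintro ⟨h₁, h₂, h₃⟩
        exact ⟨h₂, fun y e => e ▸ h₁, h₃⟩
      · rintro ⟨h₂, h₁, h₃⟩
        exact ⟨h₁ x rfl, h₂, h₃⟩
    · rw [List.reduceOption_cons_of_some, respects_cons, doc_cons]
      have h := ih p hp
      simp only [Fits, MoveOK, and_assoc, exists_eq_left, h]
      simp only [doc, List.filterMap_cons, List.filterMap_nil, List.length_nil,
        reduceCtorEq, false_imp_iff, true_and, List.nil_append, add_zero, RefLetter.vclose.injEq]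
      constructor
      · rintro ⟨h₁, h₂, h₃⟩
        exact ⟨h₂, fun y e => e ▸ h₁, h₃⟩
      · rintro ⟨h₂, h₁, h₃⟩
        exact ⟨h₁ x rfl, h₂, h₃⟩

end Fits

theorem stepOK_iff {s k n : ℕ} (asg : Asg) (d : List (Fin s)) (q q' : Fin n)
    (o : Option (RefLetter (Fin s) (Fin k))) (u v : ℕ × ℕ) :
    stepOK asg (strRep d) ((q : ℕ), labelRep o, (q' : ℕ)) u v = true ↔
      u.1 = q ∧ v.1 = q' ∧ MoveOK asg d o u.2 v.2 := by
  rcases o with _ | a | x | x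
  · simp [stepOK, labelRep, MoveOK]
  · simp only [stepOK, labelRep, MoveOK, decide_true, cond_true, Bool.and_eq_true, decide_eq_true_eq,
      List.head?_drop, strRep, List.getElem?_map, Option.map_eq_some_iff]
    refine and_congr_right fun _ => and_congr_right fun _ => and_congr_right fun _ => ?_
    constructor
    · rintro ⟨b, hb, e⟩
      rw [hb, Fin.ext e]
    · exact fun h => ⟨a, h, rfl⟩
  · simp [stepOK, labelRep, MoveOK, or_iff_not_imp_left]
    exact fun _ _ _ => ⟨fun h a b c h' e => h a b c h' (decide_eq_true e),
      fun h a b c h' e => h a b c h' (of_decide_eq_true e)⟩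
  · simp [stepOK, labelRep, MoveOK, or_iff_not_imp_left]
    exact fun _ _ _ => ⟨fun h a b c h' e => h a b c h' (decide_eq_true e),
      fun h a b c h' e => h a b c h' (of_decide_eq_true e)⟩

theorem mem_transList {s k n : ℕ} (A : VSA (Fin s) (Fin k) (Fin n))
    (e : Fin n × Option (RefLetter (Fin s) (Fin k)) × Fin n) :
    e ∈ transList A ↔ A.delta e.1 e.2.1 e.2.2 = true := by
  obtain ⟨q, o, q'⟩ := e
  have : o ∈ allLabels s k := by
    rcases o with _ | a | x | x <;> simp [allLabels]
  simp [transList, this]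

/-- The edges between configurations. -/
def edgeOK {c : ℕ} (I : Instance c) (asg : Asg) (u v : ℕ × ℕ) : Bool :=
  (instRep I).2.2.2.2.2.1.any fun t => stepOK asg (strRep I.document) t u v

theorem edgeOK_iff {c : ℕ} (I : Instance c) (asg : Asg) (u v : ℕ × ℕ) :
    edgeOK I asg u v = true ↔ ∃ q o q', I.aut.delta q o q' = true ∧
      u.1 = q ∧ v.1 = q' ∧ MoveOK asg I.document o u.2 v.2 := by
  simp only [edgeOK, instRep, List.any_map, List.any_eq_true, Function.comp_def, mem_transList,
    stepOK_iff]
  constructor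
  · rintro ⟨⟨q, o, q'⟩, h⟩
    exact ⟨q, o, q', h⟩
  · rintro ⟨q, o, q', h⟩
    exact ⟨⟨q, o, q'⟩, h⟩

theorem mem_configs {n : ℕ} {d : List ℕ} {v : ℕ × ℕ} :
    v ∈ configs n d ↔ v.1 < n ∧ v.2 ≤ d.length := by
  obtain ⟨q, p⟩ := v
  simp [configs]

/-- The product construction: a path of configurations is a path of the automaton together with the
positions that its labels force. The `ε`-labels are kept in `w`, so the two kinds of paths
correspond edge by edge. -/
theorem reachable_iff {c : ℕ} (I : Instance c) (asg : Asg) (q q' : Fin I.numStates) (p : ℕ) :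
    Relation.ReflTransGen (fun u v => edgeOK I asg u v = true) ((q : ℕ), p)
      ((q' : ℕ), I.document.length) ↔
      ∃ w, I.aut.toεNFA.IsPath q q' w ∧ Fits asg I.document w p := by
  constructor
  · intro h
    generalize hu : ((q : ℕ), p) = u at h
    induction h using Relation.ReflTransGen.head_induction_on generalizing q p with
    | refl =>
      obtain ⟨h₁, h₂⟩ := Prod.mk.inj hu
      obtain rfl := Fin.ext h₁
      exact ⟨[], .nil _, h₂⟩
    | @head u v e _ ih =>
      subst hu
      obtain ⟨q₁, o, q₂, hd, h₁, h₂, hm⟩ := (edgeOK_iff _ _ _ _).1 e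
      obtain rfl := Fin.ext h₁
      obtain ⟨w, hw, hf⟩ := ih q₂ v.2 (Prod.ext h₂.symm rfl)
      exact ⟨o :: w, .cons _ _ _ _ _ hd hw, v.2, hm, hf⟩
  · rintro ⟨w, hw, hf⟩
    induction hw generalizing p with
    | nil s =>
      rw [Fits] at hf
      rw [hf]
    | cons t s u o w hd _ ih =>
      obtain ⟨p', hm, hf⟩ := hf
      exact .head ((edgeOK_iff _ _ _ _).2 ⟨s, o, t, hd, rfl, rfl, hm⟩) (ih p' hf)

/-- Validity of `r` plays no role yet; the search constrains only the operations on variables that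
the assignment mentions. -/
theorem acceptsAsg_iff {c : ℕ} (I : Instance c) (asg : Asg) :
    acceptsAsg (instRep I) asg = true ↔
      ∃ r ∈ I.aut.refLang, doc r = I.document ∧ Respects asg 0 r := by
  have hlen : (strRep I.document).length = I.document.length := List.length_map _
  have hreach := fun v => mem_reachList (v := v)
    (N := configs I.numStates (strRep I.document)) (edge := edgeOK I asg)
    (R := (configs I.numStates (strRep I.document)).filter fun v =>
      (instRep I).2.2.2.1.any (fun q => decide (q = v.1)) && decide (v.2 = 0))
    (fun v hv => (List.mem_filter.1 hv).1) (by
      -- Edges do not leave the set of configurations: only reading a letter advances the position,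
      -- and this requires a letter at the old one.
      intro u hu v e
      obtain ⟨q, o, q', hd, h₁, h₂, hm⟩ := (edgeOK_iff _ _ _ _).1 e
      rw [mem_configs] at hu ⊢
      rw [h₂, hlen] at *
      refine ⟨q'.2, ?_⟩
      rcases o with _ | a | x | x
      · exact (hm : v.2 = u.2) ▸ hu.2
      · obtain ⟨h₃, h₄⟩ := hm
        have := (List.getElem?_eq_some_iff.1 h₄).1
        omega
      · exact hm.1 ▸ hu.2
      · exact hm.1 ▸ hu.2)
  have h₀ : acceptsAsg (instRep I) asg = true ↔
      ∃ q q', I.aut.init q = true ∧ I.aut.final q' = true ∧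
        Relation.ReflTransGen (fun u v => edgeOK I asg u v = true) ((q : ℕ), 0)
          ((q' : ℕ), I.document.length) := by
    change (reachList (configs I.numStates (strRep I.document)) (edgeOK I asg)
      ((configs I.numStates (strRep I.document)).filter fun v =>
        (instRep I).2.2.2.1.any (fun q => decide (q = v.1)) && decide (v.2 = 0))).any (fun v =>
        (instRep I).2.2.2.2.1.any (fun q => decide (q = v.1)) &&
          decide (v.2 = (strRep I.document).length)) = true ↔ _
    rw [List.any_eq_true]
    constructor
    · rintro ⟨v, hv, hv'⟩
      obtain ⟨u, hu, h⟩ := (hreach v).1 hv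
      simp only [instRep, List.mem_filter, List.any_map, List.any_eq_true, Function.comp_def,
        Bool.and_eq_true, decide_eq_true_eq, hlen, List.mem_finRange, true_and] at hu hv'
      obtain ⟨_, ⟨q, hq, e₁⟩, e₂⟩ := hu
      obtain ⟨⟨q', hq', e₃⟩, e₄⟩ := hv'
      refine ⟨q, q', hq, hq', ?_⟩
      rw [e₁, e₃, ← e₂, ← e₄]
      exact h
    · rintro ⟨q, q', hq, hq', h⟩
      refine ⟨((q' : ℕ), I.document.length), (hreach _).2 ⟨((q : ℕ), 0), ?_, h⟩, ?_⟩
      · simp only [instRep, List.mem_filter, List.any_map, List.any_eq_true, Function.comp_def,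
          Bool.and_eq_true, decide_eq_true_eq, List.mem_finRange, true_and, mem_configs]
        exact ⟨⟨q.2, Nat.zero_le _⟩, ⟨q, hq, rfl⟩, trivial⟩
      · simp only [instRep, List.mem_filter, List.any_map, List.any_eq_true, Function.comp_def,
          Bool.and_eq_true, decide_eq_true_eq, List.mem_finRange, true_and, hlen, and_true]
        exact ⟨q', hq', rfl⟩
  rw [h₀]
  simp only [reachable_iff, VSA.refLang, εNFA.mem_accepts_iff_exists_path,
    fits_iff _ _ _ (Nat.zero_le _), List.drop_zero]
  constructor
  · rintro ⟨q, q', hq, hq', w, hw, h⟩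
    exact ⟨_, ⟨q, q', w, hq, hq', rfl, hw⟩, h⟩
  · rintro ⟨_, ⟨q, q', w, hq, hq', rfl, hw⟩, h⟩
    exact ⟨q, q', hq, hq', w, hw, h⟩


/-! ### Assignments and tuples -/

theorem mem_assigns {c : ℕ} {pos X : List ℕ} (h : X.length ≤ c) {asg : Asg} :
    asg ∈ assigns c pos X ↔ asg.map (fun e => e.1) = X ∧ ∀ e ∈ asg, e.2.1 ∈ pos ∧ e.2.2 ∈ pos := by
  induction c generalizing X asg with
  | zero =>
    obtain rfl : X = [] := by simpa using h
    simp only [assigns, List.mem_singleton, List.map_eq_nil_iff]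
    exact ⟨fun e => ⟨e, by simp [e]⟩, fun e => e.1⟩
  | succ c ih =>
    rcases X with _ | ⟨x, X⟩
    · simp only [assigns, listElim, List.mem_singleton, List.map_eq_nil_iff]
      exact ⟨fun e => ⟨e, by simp [e]⟩, fun e => e.1⟩
    · simp only [assigns, listElim, List.mem_flatMap, List.mem_map]
      constructor
      · rintro ⟨i, hi, j, hj, a, ha, rfl⟩
        rw [ih (by simpa using h)] at ha
        exact ⟨by simp [ha.1], by simpa using ⟨⟨hi, hj⟩, fun a b c h => ha.2 (a, b, c) h⟩⟩
      · rintro ⟨h₁, h₂⟩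
        rcases asg with _ | ⟨⟨y, i, j⟩, asg⟩
        · simp at h₁
        · obtain ⟨rfl, rfl⟩ := List.cons.inj h₁
          have h₃ := h₂ _ List.mem_cons_self
          refine ⟨i, h₃.1, j, h₃.2, asg, ?_, rfl⟩
          rw [ih (by simpa using h)]
          exact ⟨rfl, fun e he => h₂ e (List.mem_cons_of_mem _ he)⟩

/-- A symbol that occurs once determines the word before it. -/
theorem append_cons_inj_of_count {β : Type} [DecidableEq β] {a : β} {r pre post pre' post' : List β}
    (hr : r.count a = 1) (h : r = pre ++ a :: post) (h' : r = pre' ++ a :: post') :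
    pre = pre' := by
  have key : ∀ {pre post : List β}, r = pre ++ a :: post → a ∉ pre := by
    rintro pre post rfl ha
    have := List.count_pos_iff.2 ha
    simp only [List.count_append, List.count_cons_self] at hr
    omega
  have h₁ := key h
  have h₂ := key h'
  have h₃ := h.symm.trans h'
  rw [List.append_eq_append_iff] at h₃
  rcases h₃ with ⟨s, e₁, e₂⟩ | ⟨s, e₁, e₂⟩
  · rcases s with _ | ⟨b, s⟩
    · simp [e₁]
    · obtain ⟨rfl, _⟩ := List.cons.inj e₂
      simp [e₁] at h₂
  · rcases s with _ | ⟨b, s⟩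
    · simp [e₁]
    · obtain ⟨rfl, _⟩ := List.cons.inj e₂
      simp [e₁] at h₁

section

variable {c : ℕ} (I : Instance c)

/-- The assignment that a tuple induces on the variables of the weight function. -/
def tupleAsg (t : Tuple I.document (Fin I.numVars)) : Asg :=
  (List.ofFn I.X).map fun x : Fin I.numVars => ((x : ℕ), (t x).i - 1, (t x).j - 1)

theorem doc_append {α V : Type} (r r' : List (RefLetter α V)) : doc (r ++ r') = doc r ++ doc r' :=
  List.filterMap_append

variable {I}

/-- In a valid ref-word each operation occurs once, so the factorizations in `Respects` are the ones
that `Encodes` provides. The subtraction of 1 arises because spans count from one, whereas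
assignments count the letters that come before. -/
theorem respects_iff {r : List (RefLetter (Fin I.numSyms) (Fin I.numVars))} (hr : ValidRef r)
    {t : Tuple I.document (Fin I.numVars)} (ht : Encodes r t) (asg : Asg) :
    Respects asg 0 r ↔ ∀ e ∈ asg, ∀ x : Fin I.numVars, e.1 = x →
      e.2.1 = (t x).i - 1 ∧ e.2.2 = (t x).j - 1 := by
  constructor
  · intro h e he x hx
    obtain ⟨pre, mid, post, h₁, h₂, h₃⟩ := ht x
    have h₄ := (h pre (mid ++ [.vclose x] ++ post) x).1 (by simp [h₁]) e he hx
    have h₅ := (h (pre ++ [.vopen x] ++ mid) post x).2 (by simp [h₁]) e he hx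
    rw [doc_append, doc_append, List.length_append, List.length_append] at h₅
    simp only [doc, List.filterMap_cons, List.filterMap_nil, List.length_nil] at h₂ h₃ h₄ h₅
    omega
  · intro h pre post x
    obtain ⟨pre', mid, post', h₁, h₂, h₃⟩ := ht x
    refine ⟨fun hp e he hx => ?_, fun hp e he hx => ?_⟩
    · obtain rfl := append_cons_inj_of_count (hr x).1 hp
        (post' := mid ++ [.vclose x] ++ post') (pre' := pre') (by simp [h₁])
      have := (h e he x hx).1
      omega
    · obtain rfl := append_cons_inj_of_count (hr x).2.1 hp
        (post' := post') (pre' := pre' ++ [.vopen x] ++ mid) (by simp [h₁])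
      have := (h e he x hx).2
      rw [doc_append, doc_append, List.length_append, List.length_append]
      simp only [doc, List.filterMap_cons, List.filterMap_nil, List.length_nil] at h₂ h₃ ⊢
      omega

/-- This is how functionality enters: any accepted ref-word found by the search comes from a tuple,
including spans for the variables outside `X`. -/
theorem exists_encodes {r : List (RefLetter (Fin I.numSyms) (Fin I.numVars))} (hr : ValidRef r)
    (hd : doc r = I.document) : ∃ t : Tuple I.document (Fin I.numVars), Encodes r t := by
  have h : ∀ x, ∃ s : Span I.document, ∃ pre mid post,
      r = pre ++ [.vopen x] ++ mid ++ [.vclose x] ++ post ∧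
      s.i = (doc pre).length + 1 ∧ s.j = s.i + (doc mid).length := by
    intro x
    obtain ⟨pre, mid, post, h⟩ := (hr x).2.2
    have hl := congrArg List.length hd
    simp only [h, doc_append, List.length_append] at hl
    exact ⟨⟨(doc pre).length + 1, (doc pre).length + 1 + (doc mid).length, by omega, by omega,
      by omega⟩, pre, mid, post, h, rfl, rfl⟩
  choose t ht using h
  exact ⟨t, ht⟩

theorem strRep_injective {s : ℕ} : Function.Injective (strRep (s := s)) :=
  List.map_injective_iff.2 Fin.val_injective

/-- The listed tuples are pairwise distinct, so at most one summand contributes at `f`, and the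
first matching row is the only one. -/
theorem relation_eq (f : Fin I.width → List (Fin I.numSyms)) :
    I.relation f = ((I.rows.filter fun row => decide (row.1 = f)).head?.elim 0 fun row => row.2) := by
  have key : ∀ rows : List ((Fin I.width → List (Fin I.numSyms)) × ℚ), (rows.map Prod.fst).Nodup →
      (rows.map fun row => Finsupp.single row.1 row.2).sum f =
        ((rows.filter fun row => decide (row.1 = f)).head?.elim 0 fun row => row.2) := by
    intro rows
    induction rows with
    | nil => simp
    | cons row rows ih =>
      intro h
      rw [List.map_cons, List.nodup_cons] at h
      rw [List.map_cons, List.sum_cons, Finsupp.add_apply, ih h.2]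
      by_cases e : row.1 = f
      · have : rows.filter (fun row => decide (row.1 = f)) = [] := by
          rw [List.filter_eq_nil_iff]
          intro row' h' e'
          rw [decide_eq_true_eq] at e'
          exact h.1 (by rw [e, ← e']; exact List.mem_map_of_mem h')
        simp [this, e]
      · simp [e]
  exact key _ I.rows_nodup

theorem weightAsg_tupleAsg (t : Tuple I.document (Fin I.numVars)) :
    weightAsg (instRep I) (tupleAsg I t) = ratRep (I.weight t) := by
  -- Cutting at the end of the span before dropping its beginning avoids computing the length `j -
  -- i`.
  have hstr : ∀ x, ((strRep I.document).take ((t x).j - 1)).drop ((t x).i - 1) =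
      strRep (t x).str := by
    intro x
    have h₁ := (t x).one_le
    have h₂ := (t x).le
    rw [List.drop_take, Span.str, strRep, strRep, List.map_take, List.map_drop]
    congr 1
    omega
  have hrow : ∀ f : Fin I.width → List (Fin I.numSyms),
      (List.ofFn f).map strRep = ((tupleAsg I t).map fun e =>
        ((strRep I.document).take e.2.2).drop e.2.1) ↔ f = fun l => (t (I.X l)).str := by
    intro f
    rw [tupleAsg, List.map_map, Function.comp_def]
    simp only [hstr]
    rw [List.map_ofFn, List.map_ofFn, List.ofFn_inj]
    constructor
    · exact fun h => funext fun l => strRep_injective (congrFun h l)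
    · rintro rfl
      rfl
  rw [Instance.weight, relation_eq, weightAsg]
  simp only [instRep, List.filter_map, Function.comp_def, hrow]
  cases I.rows.filter fun row => decide (row.1 = fun l => (t (I.X l)).str) <;> rfl

/-- An accepted assignment has a ref-word that respects it; by functionality this word encodes a
tuple, and the tuple induces the given assignment on `X`. Conversely, the assignment induced by an
extracted tuple is among the candidates, and the ref-word of the tuple respects it. -/
theorem mem_weights (r : RatRep) : r ∈ weights c (instRep I) ↔ ∃ q ∈ I.img, ratRep q = r := by
  have hlen : (strRep I.document).length = I.document.length := List.length_map _
  have hX : ((List.ofFn I.X).map Fin.val).length ≤ c := by simpa using I.width_le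
  have h₀ : r ∈ weights c (instRep I) ↔ ∃ asg : Asg,
      (asg.map (fun e => e.1) = (List.ofFn I.X).map Fin.val ∧
        ∀ e ∈ asg, e.2.1 ≤ I.document.length ∧ e.2.2 ≤ I.document.length) ∧
      acceptsAsg (instRep I) asg = true ∧ weightAsg (instRep I) asg = r := by
    rw [weights, List.mem_map]
    simp only [List.mem_filter, instRep, mem_assigns hX, List.mem_range, hlen, Nat.lt_succ_iff,
      and_assoc]
  rw [h₀]
  simp only [Instance.img, Set.Finite.mem_toFinset, Set.mem_image, acceptsAsg_iff]
  constructor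
  · rintro ⟨asg, ⟨h₁, -⟩, ⟨w, hw, hd, hres⟩, rfl⟩
    have hv := I.functional w hw
    obtain ⟨t, ht⟩ := exists_encodes hv hd
    refine ⟨_, ⟨t, ⟨w, hw, hd, ht⟩, rfl⟩, ?_⟩
    rw [← weightAsg_tupleAsg]
    congr 1
    rw [respects_iff hv ht] at hres
    rw [tupleAsg]
    clear h₀
    -- The assignment lists the variables of `X` in order, and `hres` fixes the positions of each,
    -- so it equals `tupleAsg I t` by induction on both lists in parallel.
    generalize List.ofFn I.X = X at h₁
    induction asg generalizing X with
    | nil =>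
      obtain rfl : X = [] := by simpa using h₁.symm
      rfl
    | cons e asg ih =>
      rcases X with _ | ⟨x, X⟩
      · simp at h₁
      · obtain ⟨e₁, e₂⟩ := List.cons.inj h₁
        obtain ⟨e₃, e₄⟩ := hres e List.mem_cons_self x e₁
        rw [List.map_cons, ih (fun e he => hres e (List.mem_cons_of_mem _ he)) X e₂, ← e₁, ← e₃,
          ← e₄]
  · rintro ⟨_, ⟨t, ⟨w, hw, hd, ht⟩, rfl⟩, rfl⟩
    refine ⟨tupleAsg I t, ⟨by simp [tupleAsg, Function.comp_def], ?_⟩, ⟨w, hw, hd, ?_⟩,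
      weightAsg_tupleAsg t⟩
    · intro e he
      obtain ⟨x, _, rfl⟩ := List.mem_map.1 he
      have h₁ := (t x).le
      have h₂ := (t x).le_length
      dsimp only
      omega
    · rw [respects_iff (I.functional w hw) ht]
      intro e he x hx
      obtain ⟨y, _, rfl⟩ := List.mem_map.1 he
      obtain rfl := Fin.ext hx
      exact ⟨rfl, rfl⟩

end

/-! ### The optimum -/

theorem bestOf_eq_some {α : Type} {le : α → α → Bool} (hle : ∀ a b, le a b = true ∨ le b a = true)
    (htrans : ∀ a b c, le a b = true → le b c = true → le a c = true) {l : List α} {m : α}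
    (h : bestOf le l = some m) : m ∈ l ∧ ∀ a ∈ l, le m a = true := by
  induction l using List.reverseRecOn generalizing m with
  | nil => simp [bestOf] at h
  | append_singleton l b ih =>
    have hb : le b b = true := (hle b b).elim id id
    rw [bestOf, List.foldl_append, ← bestOf] at h
    rcases ho : bestOf le l with _ | m'
    · have hl : l = [] := by
        rcases List.eq_nil_or_concat l with rfl | ⟨l', a, rfl⟩
        · rfl
        · rw [List.concat_eq_append, bestOf, List.foldl_append, ← bestOf] at ho
          rcases h' : bestOf le l' with _ | a'
          · simp [h'] at ho
          · cases h'' : le a a' <;> simp [h', h''] at ho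
      subst hl
      obtain rfl : b = m := by simpa [bestOf] using h
      simpa using hb
    · obtain ⟨h₁, h₂⟩ := ih ho
      cases hc : le b m'
      · obtain rfl : m' = m := by simpa [ho, hc] using h
        have hm := (hle b m').resolve_left (by simp [hc])
        simp only [List.mem_append, List.mem_singleton]
        exact ⟨.inl h₁, by rintro a (ha | rfl); exacts [h₂ a ha, hm]⟩
      · obtain rfl : b = m := by simpa [ho, hc] using h
        simp only [List.mem_append, List.mem_singleton]
        exact ⟨.inr trivial, by rintro a (ha | rfl); exacts [htrans _ _ _ hc (h₂ a ha), hb]⟩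

theorem bestOf_eq_none {α : Type} {le : α → α → Bool} {l : List α} (h : bestOf le l = none) :
    l = [] := by
  rcases List.eq_nil_or_concat l with rfl | ⟨l', a, rfl⟩
  · rfl
  · rw [List.concat_eq_append, bestOf, List.foldl_append, ← bestOf] at h
    rcases h' : bestOf le l' with _ | a'
    · simp [h'] at h
    · cases h'' : le a a' <;> simp [h', h''] at h

/-- This moves the selection from representations to rational numbers: `leRat` is known to be a
total order only on representations of the form `ratRep q`. -/
theorem bestOf_map {α β : Type} {le : α → α → Bool} {le' : β → β → Bool} {f : β → α}
    (h : ∀ a b, le (f a) (f b) = le' a b) (l : List β) :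
    bestOf le (l.map f) = (bestOf le' l).map f := by
  induction l using List.reverseRecOn with
  | nil => rfl
  | append_singleton l b ih =>
    rw [List.map_append, bestOf, bestOf, List.foldl_append, List.foldl_append, ← bestOf, ← bestOf,
      ih]
    rcases bestOf le' l with _ | m
    · rfl
    · cases h' : le' b m <;> simp [h, h']

theorem outRep_map (o : Option ℚ) : outRep (o.map ratRep) = encValue o := by
  cases o <;> rfl

theorem exists_rat_list {c : ℕ} (I : Instance c) :
    ∃ l : List ℚ, l.map ratRep = weights c (instRep I) ∧ ∀ q ∈ l, q ∈ I.img := by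
  have h : ∀ r ∈ weights c (instRep I), ∃ q ∈ I.img, ratRep q = r := fun r hr => (mem_weights r).1 hr
  generalize weights c (instRep I) = L at h
  induction L with
  | nil => exact ⟨[], rfl, by simp⟩
  | cons r L ih =>
    obtain ⟨l, h₁, h₂⟩ := ih fun r hr => h r (List.mem_cons_of_mem _ hr)
    obtain ⟨q, hq, rfl⟩ := h r List.mem_cons_self
    exact ⟨q :: l, by rw [List.map_cons, h₁], by simpa using ⟨hq, h₂⟩⟩

/-- The order of two rationals can be read off their representations, so equal representations give
inequalities in both directions. -/
theorem ratRep_injective : Function.Injective ratRep := by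
  intro p q h
  apply le_antisymm
  · have := leRat_ratRep p q
    rw [h, leRat_ratRep q q] at this
    simpa using this
  · have := leRat_ratRep q p
    rw [h, leRat_ratRep q q] at this
    simpa using this

/-- Minimum and maximum are treated at once: all that matters is that an element of `I.img`
dominating the others determines the aggregate. -/
theorem aggWord_eq {c : ℕ} (I : Instance c) {le : RatRep → RatRep → Bool} {le' : ℚ → ℚ → Bool}
    (h : ∀ a b, le (ratRep a) (ratRep b) = le' a b) (hle : ∀ a b, le' a b = true ∨ le' b a = true)
    (htrans : ∀ a b c, le' a b = true → le' b c = true → le' a c = true) {o : Option ℚ}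
    (hnone : I.img = ∅ → o = none)
    (hsome : ∀ m ∈ I.img, (∀ q ∈ I.img, le' m q = true) → o = some m) :
    aggWord c le (encInstance I) = encValue o := by
  obtain ⟨l, h₁, h₂⟩ := exists_rat_list I
  have h₃ : ∀ q, q ∈ I.img ↔ q ∈ l := by
    refine fun q => ⟨fun hq => ?_, h₂ q⟩
    have := (mem_weights _).2 ⟨q, hq, rfl⟩
    rw [← h₁] at this
    obtain ⟨q', hq', e⟩ := List.mem_map.1 this
    exact ratRep_injective e ▸ hq'
  rw [aggWord, parseInst_eq, ← h₁, bestOf_map h, outRep_map]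
  congr 1
  rcases hb : bestOf le' l with _ | m
  · refine (hnone (Finset.eq_empty_of_forall_notMem fun q => ?_)).symm
    rw [h₃, bestOf_eq_none hb]
    simp
  · obtain ⟨h₄, h₅⟩ := bestOf_eq_some hle htrans hb
    exact (hsome m ((h₃ m).2 h₄) fun q hq => h₅ q ((h₃ q).1 hq)).symm

theorem inFP_minAgg (c : ℕ) : InFP (encInstance (c := c)) encValue Instance.minAgg := by
  refine (pt_aggWord c (le := leRat) (by fun_prop)).inFP fun I =>
    aggWord_eq I (le' := fun p q => decide (p ≤ q)) leRat_ratRep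
      (fun a b => by simpa using le_total a b)
      (fun a b c h₁ h₂ => by
        rw [decide_eq_true_eq] at *
        exact h₁.trans h₂) ?_ ?_
  · intro h
    simp [Instance.minAgg, h]
  · intro m hm h
    rw [Instance.minAgg, dif_pos ⟨m, hm⟩]
    exact congrArg some (le_antisymm (Finset.min'_le _ _ hm)
      (Finset.le_min' _ _ _ fun q hq => by simpa using h q hq))

theorem inFP_maxAgg (c : ℕ) : InFP (encInstance (c := c)) encValue Instance.maxAgg := by
  refine (pt_aggWord c (le := fun a b => leRat b a) (by fun_prop)).inFP fun I =>
    aggWord_eq I (le' := fun p q => decide (q ≤ p)) (fun a b => leRat_ratRep b a)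
      (fun a b => by simpa using le_total b a)
      (fun a b c h₁ h₂ => by
        rw [decide_eq_true_eq] at *
        exact h₂.trans h₁) ?_ ?_
  · intro h
    simp [Instance.maxAgg, h]
  · intro m hm h
    rw [Instance.maxAgg, dif_pos ⟨m, hm⟩]
    exact congrArg some (le_antisymm
      (Finset.max'_le _ _ _ fun q hq => by simpa using h q hq) (Finset.le_max' _ _ hm))

end DocSpanner

theorem mainTheorem5 (c : ℕ) (hc : 1 ≤ c) :
    DocSpanner.InFP (DocSpanner.encInstance (c := c)) DocSpanner.encValue
        DocSpanner.Instance.minAgg ∧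
      DocSpanner.InFP (DocSpanner.encInstance (c := c)) DocSpanner.encValue
        DocSpanner.Instance.maxAgg :=
  ⟨DocSpanner.inFP_minAgg c, DocSpanner.inFP_maxAgg c⟩
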